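/- Let $\mathbb{R}^d$ be equipped with an arbitrary norm $\|\cdot\|$, let $(\mathbf{X},Y)$ be a random pair with values in $\mathbb{R}^d\times\{-1,1\}$, and let $(\mathbf{X}_1,Y_1),\dots,(\mathbf{X}_n,Y_n)$ be i.i.d. copies of it. Let $0<\alpha<1$ with $n\alpha\ge 1$, and let $t_\alpha=\inf\{t\in\mathbb{R}:\ \mathbb{P}(\|\mathbf{X}\|>t)\le\alpha\}$ be the $(1-\alpha)$-th quantile of $\|\mathbf{X}\|$. Assume that $\mathbb{P}(\|\mathbf{X}\|=t)=0$ for every $t\ge t_\alpha$. For a measurable classifier $g:\mathbb{R}^d\to\{-1,1\}$ put $$L_\alpha(g)=\frac1\alpha\,\mathbb{P}\big(Y\ne g(\mathbf{X}),\ \|\mathbf{X}\|>t_\alpha\big),\qquad \widehat L_{\alpha,n}(g)=\frac1{n\alpha}\sum_{i=1}^n \mathbf 1\big\{Y_i\ne g(\mathbf{X}_i),\ \|\mathbf{X}_i\|>\|\mathbf{X}_{(\lfloor n\alpha\rfloor)}\|\big\},$$ where $\|\mathbf{X}_{(1)}\|\ge\dots\ge\|\mathbf{X}_{(n)}\|$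 are the order statistics of the norms of the sample. Let $\mathcal G$ be a class of measurable classifiers of finite VC dimension $V_{\mathcal G}\ge 1$ satisfying the usual measurability requirement of empirical process theory: for all $m$ and all real $e_1,\dots,e_m$, the supremum over $g\in\mathcal G$ of $|\sum_{i=1}^m e_i\mathbf 1\{g(x_i)\ne y_i\}|$ is measurable on the completion of the $m$-fold product of the law of $(\mathbf{X},Y)$ (for instance, $\mathcal G$ is countable). Then $L_\alpha(g)=\mathbb{P}\big(Y\ne g(\mathbf{X})\,\big|\,\|\mathbf{X}\|\ge t_\alpha\big)$ for every $g\in\mathcal G$. Moreover, for every $\delta_0\in(0,1)$ there is a constant $C>0$ depending only on $\delta_0$ (not on $d$, the norm, the law of $(\mathbf{X},Y)$, $\mathcal G$, $n$, $\alpha$ or $\delta$) such that for all $0<\delta\le\delta_0$, with probability at least $1-\delta$, $$\sup_{g\in\mathcal G}\big|\widehat L_{\alpha,n}(g)-L_\alpha(g)\big|\ \le\ C\left[\sqrt{\frac{V_{\mathcal G}}{n\alpha}\log\frac1\delta}+\frac1{n\alpha}\log\frac1\delta\right].$$ -/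

import Mathlib

open MeasureTheory ProbabilityTheory

namespace ExtremeClassification

noncomputable section

/-- The class `G` of classifiers with labels in `{-1, 1} = ℤˣ` shatters the finite set `S`:
every labelling of `S` is realised by some member of `G`. -/
def Shatters {E : Type*} (G : Set (E → ℤˣ)) (S : Finset E) : Prop :=
  ∀ T ⊆ S, ∃ g ∈ G, ∀ x ∈ S, g x = 1 ↔ x ∈ T

/-- The VC dimension of a class of classifiers: the supremum of the cardinalities of the finite
sets that it shatters (`⊤` if these are unbounded). -/
def vcDimension {E : Type*} (G : Set (E → ℤˣ)) : ℕ∞ :=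
  ⨆ (S : Finset E) (_ : Shatters G S), (S.card : ℕ∞)

/-- `orderStat v k` is the `k`-th largest value `v_(k)` among `v_1, …, v_n`, for `1 ≤ k ≤ n`, so
that `v_(1) ≥ … ≥ v_(n)` (and `0` for other `k`). -/
def orderStat {n : ℕ} (v : Fin n → ℝ) (k : ℕ) : ℝ :=
  if h : 1 ≤ k ∧ k ≤ n then v (Tuple.sort (fun i => -v i) ⟨k - 1, by omega⟩) else 0

variable {E : Type*} [NormedAddCommGroup E] [MeasurableSpace E]

/-- The `(1 - α)`-th quantile `t_α` of `‖X‖`, where `(X, Y)` has law `μ`: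
`t_α = inf {t | P(‖X‖ > t) ≤ α}`. -/
def normQuantile (μ : Measure (E × ℤˣ)) (α : ℝ) : ℝ :=
  sInf {t : ℝ | μ.real {z | t < ‖z.1‖} ≤ α}

/-- The risk of `g` on the extremes: `L_α(g) = P(Y ≠ g(X), ‖X‖ > t_α) / α`. -/
def extremeRisk (μ : Measure (E × ℤˣ)) (α : ℝ) (g : E → ℤˣ) : ℝ :=
  (1 / α) * μ.real {z | z.2 ≠ g z.1 ∧ normQuantile μ α < ‖z.1‖}

/-- The empirical risk of `g` on the extremes of the sample `z`:
`L_{α,n}(g) = (1 / (n α)) ∑ i, 1{Y_i ≠ g(X_i), ‖X_i‖ > ‖X_(⌊nα⌋)‖}`. -/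
def empiricalExtremeRisk {n : ℕ} (α : ℝ) (z : Fin n → E × ℤˣ) (g : E → ℤˣ) : ℝ :=
  (1 / (n * α)) * ∑ i : Fin n,
    if (z i).2 ≠ g (z i).1 ∧ orderStat (fun j => ‖(z j).1‖) ⌊n * α⌋₊ < ‖(z i).1‖
    then (1 : ℝ) else 0

/-- The standard measurability requirement of empirical process theory ("`μ`-measurable class")
for the error indicators `1{g(x) ≠ y}`, `g ∈ G`: each `g` is measurable and, for every `m` and all
weights `e_1, …, e_m`, the supremum over `g ∈ G` of `|∑ i, e_i 1{g(x_i) ≠ y_i}|` is measurable on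
the completion of the `m`-fold product space. Every countable class of measurable functions has
this property. -/
def IsMeasurableClass (μ : Measure (E × ℤˣ)) (G : Set (E → ℤˣ)) : Prop :=
  (∀ g ∈ G, Measurable g) ∧
  ∀ (m : ℕ) (e : Fin m → ℝ),
    AEMeasurable
      (fun z : Fin m → E × ℤˣ =>
        ⨆ g : G, |∑ i : Fin m, e i * if (z i).2 ≠ g.1 (z i).1 then (1 : ℝ) else 0|)
      (Measure.pi fun _ => μ)

end

end ExtremeClassification

/-! Write x = nα and ℓ = log(1/δ). Two errors must be controlled: the fluctuation of the number of
misclassified points above the fixed level t_α, uniformly in g, and the replacement of t_α by an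
order statistic. Norms above t_α have almost surely no ties, so about x points exceed the order
statistic, and the replacement changes each error count by at most |#{i : ‖X_i‖ > t_α} − x| + 2
(`abs_card_orderStat_sub_le`). This is again a deviation of an empirical count, now of the tail
region U itself.

Both deviations come from one exponential-moment estimate (`measure_deviation_le`). A ghost sample
and random swaps of pairs reduce it to a Rademacher process indexed by the traces of the class on
the sample. These traces lie in the set of sample points that fall in U, so the variance is governed
by their number, whose mean is nα rather than n. Chaining (`sum_exp_rademacher_sup_le`) bounds the
exponential moment with a term linear in V and no factor log n. It rests on a polynomial bound for
packing numbers (`log_card_le_of_separated`), which follows from Sauer–Shelah and random sampling of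
coordinates.

Markov's inequality with exponent of order √((V + ℓ)/x) gives a relative error of order √((V + ℓ)/x)
+ 1/x. Since V ≥ 1 and ℓ ≥ log(1/δ₀) > 0, the sum V + ℓ is at most a constant times Vℓ. When x < V
or x < ℓ the bound is trivial, as both risks lie in [0, 1]. -/

namespace ExtremeClassification

/-! ### Packing numbers of families of finite VC dimension. -/

section Combinatorics

open Finset

variable {α : Type*} [DecidableEq α]

/-- Sauer–Shelah lemma in weighted form. -/
theorem card_mul_pow_le_of_shatters {𝒯 : Finset (Finset α)} {T : Finset α} {V : ℕ}
    (hT : ∀ A ∈ 𝒯, A ⊆ T) (hV : ∀ s, 𝒯.Shatters s → #s ≤ V) {x : ℝ} (hx : 0 < x) (hx1 : x ≤ 1) :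
    (#𝒯 : ℝ) * x ^ V ≤ (1 + x) ^ #T := by
  have h1 : (#𝒯 : ℝ) ≤ #𝒯.shatterer := by exact_mod_cast card_le_card_shatterer 𝒯
  have h2 : 𝒯.shatterer ⊆ T.powerset := by
    intro s hs
    obtain ⟨t, ht, hst⟩ := (mem_shatterer.1 hs).exists_superset
    exact mem_powerset.2 (hst.trans (hT t ht))
  calc (#𝒯 : ℝ) * x ^ V ≤ #𝒯.shatterer * x ^ V := by gcongr
    _ = ∑ s ∈ 𝒯.shatterer, x ^ V := by simp
    _ ≤ ∑ s ∈ 𝒯.shatterer, x ^ #s := by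
        refine sum_le_sum fun s hs => ?_
        exact pow_le_pow_of_le_one hx.le hx1 (hV s (mem_shatterer.1 hs))
    _ ≤ ∑ s ∈ T.powerset, x ^ #s :=
        sum_le_sum_of_subset_of_nonneg h2 fun _ _ _ => by positivity
    _ = (1 + x) ^ #T := by
        have := sum_pow_mul_eq_add_pow x 1 T
        simp only [one_pow, mul_one] at this
        rw [this, add_comm]

/-- Pairwise well separated sets are distinguished by few points. -/
theorem exists_injOn_inter {ℳ : Finset (Finset α)} {U : Finset α} {ε : ℝ} {k : ℕ}
    (hU : U.Nonempty) (hℳ : ℳ.Nonempty)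
    (hsub : ∀ A ∈ ℳ, A ⊆ U)
    (hsep : ∀ A ∈ ℳ, ∀ B ∈ ℳ, A ≠ B → ε * #U < #(symmDiff A B))
    (hk : 2 * Real.log #ℳ ≤ ε * k) :
    ∃ T : Finset α, #T ≤ k ∧ Set.InjOn (fun A => A ∩ T) (ℳ : Set (Finset α)) := by
  by_contra! hcon
  -- Union bound over k-tuples drawn from U: if no T works, every tuple misses the symmetric
  -- difference of some pair. A fixed pair is missed by at most a fraction exp(-εk) ≤ 1/(#ℳ)² of the
  -- tuples, and there are fewer than (#ℳ)² pairs.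
  have hcov : Fintype.piFinset (fun _ : Fin k => U) ⊆
      ℳ.offDiag.biUnion fun p => Fintype.piFinset fun _ : Fin k => U \ symmDiff p.1 p.2 := by
    intro φ hφ
    have hni := hcon (univ.image φ) (card_image_le.trans (by simp))
    simp only [Set.InjOn, not_forall] at hni
    obtain ⟨A, hA, B, hB, hAB, hne⟩ := hni
    refine mem_biUnion.2 ⟨(A, B), mem_offDiag.2 ⟨hA, hB, hne⟩, Fintype.mem_piFinset.2 fun i => ?_⟩
    refine mem_sdiff.2 ⟨Fintype.mem_piFinset.1 hφ i, fun hi => ?_⟩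
    have := congrArg (fun S => φ i ∈ S) hAB
    simp only [mem_inter, mem_image, mem_univ, true_and, exists_apply_eq_apply, and_true,
      eq_iff_iff] at this
    simp only [mem_symmDiff] at hi
    tauto
  have hN : (0 : ℝ) < #U := by exact_mod_cast hU.card_pos
  have hM : (0 : ℝ) < #ℳ := by exact_mod_cast hℳ.card_pos
  have hterm : ∀ p ∈ ℳ.offDiag,
      ((#(Fintype.piFinset fun _ : Fin k => U \ symmDiff p.1 p.2) : ℕ) : ℝ) ≤
        (#U : ℝ) ^ k / (#ℳ : ℝ) ^ 2 := by
    intro p hp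
    obtain ⟨hA, hB, hne⟩ := mem_offDiag.1 hp
    have hsd : symmDiff p.1 p.2 ⊆ U := by
      intro x hx
      rcases mem_symmDiff.1 hx with h | h
      · exact hsub _ hA h.1
      · exact hsub _ hB h.1
    have hc : ((#(U \ symmDiff p.1 p.2) : ℕ) : ℝ) ≤ #U * Real.exp (-ε) := by
      rw [cast_card_sdiff hsd]
      have := hsep _ hA _ hB hne
      have h3 := Real.add_one_le_exp (-ε)
      nlinarith
    rw [Fintype.card_piFinset_const, Nat.cast_pow]
    calc ((#(U \ symmDiff p.1 p.2) : ℕ) : ℝ) ^ k ≤ (#U * Real.exp (-ε)) ^ k := by gcongr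
      _ = #U ^ k * Real.exp (-(ε * k)) := by
          rw [mul_pow, ← Real.exp_nat_mul]; ring_nf
      _ ≤ #U ^ k * Real.exp (-(2 * Real.log #ℳ)) := by gcongr
      _ = (#U : ℝ) ^ k / (#ℳ : ℝ) ^ 2 := by
          rw [Real.exp_neg, two_mul, Real.exp_add, Real.exp_log hM]; field_simp
  have h1 : ((#U : ℝ)) ^ k ≤ #ℳ.offDiag * ((#U : ℝ) ^ k / (#ℳ : ℝ) ^ 2) := by
    have := (card_le_card hcov).trans card_biUnion_le
    rw [Fintype.card_piFinset_const] at this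
    have h2 : ((#U : ℝ)) ^ k ≤ ∑ p ∈ ℳ.offDiag,
      ((#(Fintype.piFinset fun _ : Fin k => U \ symmDiff p.1 p.2) : ℕ) : ℝ) := by exact_mod_cast this
    refine h2.trans ((sum_le_sum hterm).trans ?_)
    simp
  have h2 : (#ℳ.offDiag : ℝ) < (#ℳ : ℝ) ^ 2 := by
    have : #ℳ.offDiag < #ℳ ^ 2 := by
      rw [offDiag_card, pow_two]
      have := hℳ.card_pos
      have : 0 < #ℳ * #ℳ := by positivity
      omega
    exact_mod_cast this
  have h3 : (0 : ℝ) < (#U : ℝ) ^ k := by positivity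
  rw [mul_div_assoc', le_div_iff₀ (by positivity)] at h1
  nlinarith

/-- The packing numbers of a family of finite VC dimension grow polynomially. -/
theorem log_card_le_of_separated {ℳ : Finset (Finset α)} {U : Finset α} {ε : ℝ} {V : ℕ}
    (hε : 0 < ε) (hε1 : ε ≤ 1) (hsub : ∀ A ∈ ℳ, A ⊆ U)
    (hsep : ∀ A ∈ ℳ, ∀ B ∈ ℳ, A ≠ B → ε * #U < #(symmDiff A B))
    (hV : ∀ s, ℳ.Shatters s → #s ≤ V) :
    Real.log #ℳ ≤ 1 / 2 + 2 * V * Real.log (4 / ε) := by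
  have hlog : 0 ≤ Real.log (4 / ε) := Real.log_nonneg (by rw [le_div_iff₀ hε]; linarith)
  have hrhs : 0 ≤ 1 / 2 + 2 * V * Real.log (4 / ε) := by positivity
  rcases le_or_gt #ℳ 1 with h1 | h1
  · refine le_trans (Real.log_nonpos (by positivity) (by exact_mod_cast h1)) hrhs
  have hℳ : ℳ.Nonempty := card_pos.1 (by omega)
  have hU : U.Nonempty := by
    by_contra hU
    rw [not_nonempty_iff_eq_empty] at hU
    obtain ⟨A, hA, B, hB, hne⟩ := one_lt_card.1 h1
    have h2 := hsub A hA; have h3 := hsub B hB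
    rw [hU, subset_empty] at h2 h3
    exact hne (h2.trans h3.symm)
  have hM : (1 : ℝ) ≤ #ℳ := by exact_mod_cast h1.le
  have hL : 0 ≤ Real.log #ℳ := Real.log_nonneg hM
  set k := ⌈2 * Real.log #ℳ / ε⌉₊ with hkdef
  have hk : 2 * Real.log #ℳ ≤ ε * k := by
    have := Nat.le_ceil (2 * Real.log #ℳ / ε)
    rw [div_le_iff₀ hε] at this
    linarith
  have hk2 : (k : ℝ) < 2 * Real.log #ℳ / ε + 1 := Nat.ceil_lt_add_one (by positivity)
  obtain ⟨T, hT, hinj⟩ := exists_injOn_inter hU hℳ hsub hsep hk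
  have hcard : #(ℳ.image fun A => A ∩ T) = #ℳ := card_image_of_injOn hinj
  -- The weight ε/4 makes the Sauer–Shelah bound contribute εk/4 ≤ (log #ℳ)/2 + 1/4, half of which
  -- can be absorbed on the left.
  have hx : 0 < ε / 4 := by positivity
  have key := card_mul_pow_le_of_shatters (𝒯 := ℳ.image fun A => A ∩ T) (T := T) (V := V)
    (by
      intro A hA
      obtain ⟨B, -, rfl⟩ := mem_image.1 hA
      exact inter_subset_right)
    (by
      intro s hs
      refine hV s fun t ht => ?_
      have hsT : s ⊆ T := by
        obtain ⟨u, hu, hsu⟩ := hs.exists_superset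
        obtain ⟨B, -, rfl⟩ := mem_image.1 hu
        exact hsu.trans inter_subset_right
      obtain ⟨u, hu, hsu⟩ := hs ht
      obtain ⟨B, hB, rfl⟩ := mem_image.1 hu
      refine ⟨B, hB, ?_⟩
      rw [← hsu, inter_comm B T, ← inter_assoc, inter_eq_left.2 hsT])
    hx (by linarith)
  rw [hcard] at key
  have key2 : (#ℳ : ℝ) * (ε / 4) ^ V ≤ Real.exp (ε / 4 * k) := by
    refine key.trans ?_
    calc (1 + ε / 4) ^ #T ≤ (1 + ε / 4) ^ k := pow_le_pow_right₀ (by linarith) hT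
      _ ≤ (Real.exp (ε / 4)) ^ k := by
          gcongr
          have := Real.add_one_le_exp (ε / 4)
          linarith
      _ = Real.exp (ε / 4 * k) := by rw [← Real.exp_nat_mul]; ring_nf
  have key3 := Real.log_le_log (by positivity) key2
  rw [Real.log_exp, Real.log_mul (by positivity) (by positivity), Real.log_pow] at key3
  have hinv : Real.log (ε / 4) = -Real.log (4 / ε) := by rw [← Real.log_inv, inv_div]
  have h4 : ε / 4 * k ≤ Real.log #ℳ / 2 + 1 / 4 := by
    have : ε * k ≤ ε * (2 * Real.log #ℳ / ε + 1) := by gcongr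
    have h5 : ε * (2 * Real.log #ℳ / ε + 1) = 2 * Real.log #ℳ + ε := by field_simp
    linarith
  rw [hinv] at key3
  linarith

/-- A family of finite VC dimension has small nets for the Hamming distance. -/
theorem exists_net {𝒜 : Finset (Finset α)} {U : Finset α} {ε : ℝ} {V : ℕ}
    (hε : 0 < ε) (hε1 : ε ≤ 1) (hsub : ∀ A ∈ 𝒜, A ⊆ U) (hV : ∀ s, 𝒜.Shatters s → #s ≤ V) :
    ∃ π : Finset α → Finset α, (∀ A ∈ 𝒜, (#(symmDiff A (π A)) : ℝ) ≤ ε * #U) ∧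
      Real.log #(𝒜.image π) ≤ 1 / 2 + 2 * V * Real.log (4 / ε) := by
  classical
  let P : Finset (Finset α) → Prop := fun ℳ =>
    ∀ A ∈ ℳ, ∀ B ∈ ℳ, A ≠ B → ε * #U < #(symmDiff A B)
  -- A largest separated subfamily is a net: a set far from all its members could be adjoined.
  obtain ⟨ℳ, hℳ, hmax⟩ := exists_max_image (𝒜.powerset.filter P) card ⟨∅, by simp [P]⟩
  rw [mem_filter, mem_powerset] at hℳ
  have hnet : ∀ A ∈ 𝒜, ∃ B ∈ ℳ, (#(symmDiff A B) : ℝ) ≤ ε * #U := by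
    intro A hA
    by_contra! hcon
    have hAM : A ∉ ℳ := fun h => by
      have := hcon A h
      simp only [symmDiff_self, bot_eq_empty, card_empty, Nat.cast_zero] at this
      have : 0 ≤ ε * #U := by positivity
      linarith
    have := hmax (insert A ℳ) (by
      rw [mem_filter, mem_powerset]
      refine ⟨insert_subset hA hℳ.1, ?_⟩
      intro B hB C hC hBC
      rcases mem_insert.1 hB with rfl | hB' <;> rcases mem_insert.1 hC with rfl | hC'
      · exact absurd rfl hBC
      · exact hcon C hC'
      · rw [symmDiff_comm]; exact hcon B hB'
      · exact hℳ.2 B hB' C hC' hBC)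
    rw [card_insert_of_notMem hAM] at this
    omega
  choose! π hπ hπ2 using hnet
  refine ⟨π, hπ2, ?_⟩
  have h1 := log_card_le_of_separated hε hε1 (fun A hA => hsub A (hℳ.1 hA)) hℳ.2
    (fun s hs => hV s (hs.mono_left hℳ.1))
  have h2 : 𝒜.image π ⊆ ℳ := fun B hB => by
    obtain ⟨A, hA, rfl⟩ := mem_image.1 hB
    exact hπ A hA
  rcases (𝒜.image π).eq_empty_or_nonempty with h | h
  · rw [h]
    have hlog : 0 ≤ Real.log (4 / ε) := Real.log_nonneg (by rw [le_div_iff₀ hε]; linarith)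
    simp only [card_empty, Nat.cast_zero, Real.log_zero]
    positivity
  · refine (Real.log_le_log ?_ ?_).trans h1
    · exact_mod_cast h.card_pos
    · exact_mod_cast card_le_card h2

end Combinatorics

/-! ### Chaining for Rademacher processes. -/

section Rademacher

open Finset

/-- The sign `±1` encoded by a Boolean. -/
def boolSign (b : Bool) : ℝ := if b then 1 else -1

variable {ι : Type*} [Fintype ι] [DecidableEq ι]

/-- The sum over signs factorises, and each factor is 2 cosh(c i) ≤ 2 exp(c i² / 2). -/
theorem sum_exp_rademacher_le (c : ι → ℝ) :
    ∑ σ : ι → Bool, Real.exp (∑ i, c i * boolSign (σ i)) ≤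
      2 ^ Fintype.card ι * Real.exp ((∑ i, c i ^ 2) / 2) := by
  have h1 : ∑ σ : ι → Bool, Real.exp (∑ i, c i * boolSign (σ i)) =
      ∏ i, ∑ b : Bool, Real.exp (c i * boolSign b) := by
    rw [prod_univ_sum, Fintype.piFinset_univ]
    exact sum_congr rfl fun σ _ => Real.exp_sum _ _
  have h2 : ∀ i, ∑ b : Bool, Real.exp (c i * boolSign b) ≤ 2 * Real.exp (c i ^ 2 / 2) := by
    intro i
    have := Real.cosh_le_exp_half_sq (c i)
    rw [Real.cosh_eq] at this
    simp only [boolSign, Fintype.sum_bool]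
    norm_num
    linarith
  rw [h1]
  calc ∏ i, ∑ b : Bool, Real.exp (c i * boolSign b) ≤ ∏ i, 2 * Real.exp (c i ^ 2 / 2) :=
        prod_le_prod (fun i _ => by positivity) fun i _ => h2 i
    _ = _ := by rw [prod_mul_distrib, ← Real.exp_sum, sum_div]; simp

/-- Common indices cancel, so the increment is a signed sum over the symmetric difference; the
absolute value costs the factor 2. -/
theorem sum_exp_abs_rademacher_sub_le (A B : Finset ι) (θ : ℝ) :
    ∑ σ : ι → Bool, Real.exp (θ * |∑ i ∈ A, boolSign (σ i) - ∑ i ∈ B, boolSign (σ i)|) ≤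
      2 ^ Fintype.card ι * (2 * Real.exp (θ ^ 2 * #(symmDiff A B) / 2)) := by
  have key : ∀ τ : ℝ, ∑ σ : ι → Bool,
      Real.exp (τ * (∑ i ∈ A, boolSign (σ i) - ∑ i ∈ B, boolSign (σ i))) ≤
      2 ^ Fintype.card ι * Real.exp (τ ^ 2 * #(symmDiff A B) / 2) := by
    intro τ
    have h := sum_exp_rademacher_le
      (fun i => τ * ((if i ∈ A then 1 else 0) - (if i ∈ B then 1 else 0)))
    have h1 : ∀ σ : ι → Bool,
        ∑ i, τ * ((if i ∈ A then 1 else 0) - (if i ∈ B then 1 else 0)) * boolSign (σ i) =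
        τ * (∑ i ∈ A, boolSign (σ i) - ∑ i ∈ B, boolSign (σ i)) := by
      intro σ
      simp only [mul_assoc, ← mul_sum, sub_mul, sum_sub_distrib, ite_mul, one_mul, zero_mul,
        sum_ite_mem, univ_inter]
    have h2 : ∑ i, (τ * ((if i ∈ A then (1 : ℝ) else 0) - (if i ∈ B then 1 else 0))) ^ 2 =
        τ ^ 2 * #(symmDiff A B) := by
      have h3 : ∀ i, (τ * ((if i ∈ A then (1 : ℝ) else 0) - (if i ∈ B then 1 else 0))) ^ 2 =
          τ ^ 2 * if i ∈ symmDiff A B then 1 else 0 := by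
        intro i
        rw [mul_pow]
        by_cases hA : i ∈ A <;> by_cases hB : i ∈ B <;> simp [mem_symmDiff, hA, hB]
      simp only [h3, ← mul_sum, sum_ite_mem, univ_inter, sum_const, nsmul_eq_mul, mul_one]
    rw [h2] at h
    simpa only [h1] using h
  have hp := key θ
  have hn := key (-θ)
  rw [neg_sq] at hn
  calc _ ≤ ∑ σ : ι → Bool,
        (Real.exp (θ * (∑ i ∈ A, boolSign (σ i) - ∑ i ∈ B, boolSign (σ i))) +
          Real.exp (-θ * (∑ i ∈ A, boolSign (σ i) - ∑ i ∈ B, boolSign (σ i)))) := by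
        refine sum_le_sum fun σ _ => ?_
        rcases abs_cases (∑ i ∈ A, boolSign (σ i) - ∑ i ∈ B, boolSign (σ i)) with h | h
        · rw [h.1]; exact le_add_of_nonneg_right (Real.exp_nonneg _)
        · rw [h.1, mul_neg, ← neg_mul]; exact le_add_of_nonneg_left (Real.exp_nonneg _)
    _ ≤ _ := by rw [sum_add_distrib]; linarith

/-- Nets at scales 4⁻ʲ, so that standard deviations halve at each level. Level 0 is replaced by the
constant ∅, so that telescoping starts from a zero sum. -/
theorem exists_chain {𝒜 : Finset (Finset ι)} {U : Finset ι} {V : ℕ}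
    (hsub : ∀ A ∈ 𝒜, A ⊆ U) (hV : ∀ s, 𝒜.Shatters s → #s ≤ V) :
    ∃ p : ℕ → Finset ι → Finset ι, (∀ A, p 0 A = ∅) ∧
      (∀ j, ∀ A ∈ 𝒜, (#(symmDiff A (p j A)) : ℝ) ≤ (1 / 4) ^ j * #U) ∧
      ∀ j, Real.log #(𝒜.image (p j)) ≤ 1 / 2 + 2 * V * ((j + 1) * Real.log 4) := by
  have hnet : ∀ j : ℕ, ∃ π : Finset ι → Finset ι,
      (∀ A ∈ 𝒜, (#(symmDiff A (π A)) : ℝ) ≤ (1 / 4) ^ j * #U) ∧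
      Real.log #(𝒜.image π) ≤ 1 / 2 + 2 * V * ((j + 1) * Real.log 4) := by
    intro j
    obtain ⟨π, h1, h2⟩ := exists_net (ε := (1 / 4) ^ j) (by positivity)
      (pow_le_one₀ (by norm_num) (by norm_num)) hsub hV
    refine ⟨π, h1, h2.trans_eq ?_⟩
    have : (4 : ℝ) / (1 / 4) ^ j = 4 ^ (j + 1) := by
      rw [one_div, inv_pow, div_inv_eq_mul, pow_succ, mul_comm]
    rw [this, Real.log_pow]
    push_cast
    ring
  choose π hπ1 hπ2 using hnet
  refine ⟨fun j => if j = 0 then fun _ => ∅ else π j, fun A => by simp, fun j A hA => ?_,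
    fun j => ?_⟩
  · rcases eq_or_ne j 0 with rfl | hj
    · have := card_le_card (hsub A hA)
      simp only [↓reduceIte, pow_zero, one_mul]
      rw [← bot_eq_empty, symmDiff_bot]
      exact_mod_cast this
    · simpa [hj] using hπ1 j A hA
  · rcases eq_or_ne j 0 with rfl | hj
    · have h0 : Real.log #(𝒜.image fun _ : Finset ι => (∅ : Finset ι)) ≤ 0 := by
        refine Real.log_nonpos (by positivity) ?_
        have : #(𝒜.image fun _ : Finset ι => (∅ : Finset ι)) ≤ 1 := card_le_one.2 (by
          intro a ha b hb
          simp only [mem_image] at ha hb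
          obtain ⟨_, _, rfl⟩ := ha
          obtain ⟨_, _, rfl⟩ := hb
          rfl)
        exact_mod_cast this
      simp only [↓reduceIte]
      refine h0.trans ?_
      have := Real.log_nonneg (show (1 : ℝ) ≤ 4 by norm_num)
      positivity
    · simpa [hj] using hπ2 j

theorem sum_range_half_pow (J : ℕ) : ∑ j ∈ range J, (1 / 2 : ℝ) ^ (j + 1) = 1 - (1 / 2) ^ J := by
  induction J with
  | zero => simp
  | succ J ih => rw [sum_range_succ, ih]; ring

theorem sum_range_half_pow_mul (J : ℕ) :
    ∑ j ∈ range J, (1 / 2 : ℝ) ^ (j + 1) * (j + 2) = 3 - (1 / 2) ^ J * (J + 3) := by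
  induction J with
  | zero => simp
  | succ J ih => rw [sum_range_succ, ih]; push_cast; ring

/-- Exponential moments of the maximum of a Rademacher process indexed by a family of finite
VC dimension, by chaining. -/
theorem sum_exp_rademacher_sup_le {𝒜 : Finset (Finset ι)} {U : Finset ι} {V : ℕ}
    (hV1 : 1 ≤ V) (hsub : ∀ A ∈ 𝒜, A ⊆ U) (hV : ∀ s, 𝒜.Shatters s → #s ≤ V)
    {l : ℝ} (hl : 0 ≤ l) (R : (ι → Bool) → ℝ)
    (hR : ∀ σ, ∃ A ∈ 𝒜, R σ ≤ |∑ i ∈ A, boolSign (σ i)|) :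
    ∑ σ, Real.exp (l * R σ) ≤ 2 ^ Fintype.card ι * Real.exp (21 * V + 4 * l ^ 2 * #U) := by
  obtain ⟨p, hp0, hp1, hp2⟩ := exists_chain hsub hV
  obtain ⟨A₀, hA₀, -⟩ := hR fun _ => true
  have hV1' : (1 : ℝ) ≤ V := by exact_mod_cast hV1
  -- At this scale a Hamming distance is below 1, hence 0, and the chain ends at A itself.
  obtain ⟨J, hJ⟩ : ∃ J : ℕ, (1 / 4 : ℝ) ^ J * #U < 1 := by
    obtain ⟨J, hJ⟩ := pow_unbounded_of_one_lt (#U : ℝ) (show (1 : ℝ) < 4 by norm_num)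
    refine ⟨J, ?_⟩
    rw [one_div, inv_pow, inv_mul_lt_iff₀ (by positivity)]
    linarith
  have hpJ : ∀ A ∈ 𝒜, p J A = A := by
    intro A hA
    have h1 : (#(symmDiff A (p J A)) : ℝ) < 1 := (hp1 J A hA).trans_lt hJ
    have h2 : #(symmDiff A (p J A)) = 0 := by
      have : #(symmDiff A (p J A)) < 1 := by exact_mod_cast h1
      omega
    exact (symmDiff_eq_bot.1 (card_eq_zero.1 h2)).symm
  set S : (ι → Bool) → Finset ι → ℝ := fun σ A => ∑ i ∈ A, boolSign (σ i) with hS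
  -- `w` are weights for Jensen's inequality: multiplying an increment by l / w j cancels the decay
  -- of its variance, leaving 4l²#U at every level. `c` is the budget of a level, covering that
  -- variance and the logarithm of the number of links; since ∑ w j * (j + 2) ≤ 3, its average is at
  -- most 21V + 4l²#U.
  set w : ℕ → ℝ := fun j => (1 / 2) ^ (j + 1) with hw
  set c : ℕ → ℝ := fun j => 7 * V * (j + 2) + 4 * l ^ 2 * #U with hc
  set Λ : ℕ → Finset (Finset ι × Finset ι) := fun j => 𝒜.image fun A => (p (j + 1) A, p j A)
    with hΛ
  have hwpos : ∀ j, 0 < w j := fun j => by positivity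
  have hwc : ∑ j ∈ range J, w j * c j ≤ 21 * V + 4 * l ^ 2 * #U := by
    have : ∑ j ∈ range J, w j * c j =
        7 * V * ∑ j ∈ range J, (1 / 2 : ℝ) ^ (j + 1) * (j + 2) +
          4 * l ^ 2 * #U * ∑ j ∈ range J, (1 / 2 : ℝ) ^ (j + 1) := by
      rw [mul_sum, mul_sum, ← sum_add_distrib]
      exact sum_congr rfl fun j _ => by simp only [hw, hc]; ring
    rw [this, sum_range_half_pow, sum_range_half_pow_mul]
    have h1 : 0 ≤ (1 / 2 : ℝ) ^ J * (J + 3) := by positivity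
    have h2 : 0 ≤ (1 / 2 : ℝ) ^ J := by positivity
    have h3 : 0 ≤ 4 * l ^ 2 * #U := by positivity
    nlinarith
  have hlink : ∀ j, ∑ q ∈ Λ j, ∑ σ, Real.exp (l / w j * |S σ q.1 - S σ q.2| - c j) ≤
      2 ^ Fintype.card ι := by
    intro j
    have hq : ∀ q ∈ Λ j, ∑ σ, Real.exp (l / w j * |S σ q.1 - S σ q.2| - c j) ≤
        2 ^ Fintype.card ι * (2 * Real.exp (4 * l ^ 2 * #U - c j)) := by
      intro q hq
      obtain ⟨A, hA, rfl⟩ := mem_image.1 hq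
      have h1 := sum_exp_abs_rademacher_sub_le (p (j + 1) A) (p j A) (l / w j)
      have h2 : (#(symmDiff (p (j + 1) A) (p j A)) : ℝ) ≤ 2 * (1 / 4) ^ j * #U := by
        have ht : symmDiff (p (j + 1) A) (p j A) ⊆
            symmDiff A (p (j + 1) A) ∪ symmDiff A (p j A) := by
          rw [symmDiff_comm A (p (j + 1) A)]
          exact symmDiff_triangle _ _ _
        have ht2 : (#(symmDiff (p (j + 1) A) (p j A)) : ℝ) ≤
            #(symmDiff A (p (j + 1) A)) + #(symmDiff A (p j A)) := by
          exact_mod_cast (card_le_card ht).trans (card_union_le _ _)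
        have h3 := hp1 (j + 1) A hA
        have h4 := hp1 j A hA
        have h5 : 0 ≤ (1 / 4 : ℝ) ^ j * #U := by positivity
        rw [pow_succ] at h3
        linarith
      have h3 : (l / w j) ^ 2 * #(symmDiff (p (j + 1) A) (p j A)) / 2 ≤ 4 * l ^ 2 * #U := by
        calc _ ≤ (l / w j) ^ 2 * (2 * (1 / 4) ^ j * #U) / 2 := by gcongr
          _ = 4 * l ^ 2 * #U := by
            have : (1 / 4 : ℝ) ^ j = 4 * w j ^ 2 := by
              simp only [hw]
              rw [← pow_mul, mul_comm (j + 1) 2, pow_mul, pow_succ]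
              norm_num
              ring
            rw [this]
            have := (hwpos j).ne'
            field_simp
      simp only [Real.exp_sub, ← sum_div]
      rw [div_le_iff₀ (Real.exp_pos _)]
      refine h1.trans ?_
      rw [mul_assoc, mul_assoc, div_mul_cancel₀ _ (Real.exp_pos _).ne']
      gcongr
    -- With log 4 ≤ 1.4 and 2 ≤ e, the exponent to beat is 2 + 2.8V(2j + 3), which is at most 7V(j +
    -- 2) because V ≥ 1.
    have hcard : (#(Λ j) : ℝ) * (2 * Real.exp (4 * l ^ 2 * #U - c j)) ≤ 1 := by
      have h1 : Λ j ⊆ 𝒜.image (p (j + 1)) ×ˢ 𝒜.image (p j) := by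
        intro q hq
        obtain ⟨A, hA, rfl⟩ := mem_image.1 hq
        exact mem_product.2 ⟨mem_image_of_mem _ hA, mem_image_of_mem _ hA⟩
      have h2 : (#(Λ j) : ℝ) ≤ #(𝒜.image (p (j + 1))) * #(𝒜.image (p j)) := by
        have := card_le_card h1
        rw [card_product] at this
        exact_mod_cast this
      have hpos : ∀ i, (0 : ℝ) < #(𝒜.image (p i)) := fun i => by
        exact_mod_cast card_pos.2 ⟨_, mem_image_of_mem (p i) hA₀⟩
      have h3 : ∀ i : ℕ, (#(𝒜.image (p i)) : ℝ) ≤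
          Real.exp (1 / 2 + 2 * V * ((i + 1) * Real.log 4)) := fun i => by
        rw [← Real.log_le_iff_le_exp (hpos i)]; exact hp2 i
      have hlog4 : Real.log 4 ≤ 1.4 := by
        rw [show (4 : ℝ) = 2 ^ 2 by norm_num, Real.log_pow]
        have := Real.log_two_lt_d9
        push_cast
        linarith
      have h2e : (2 : ℝ) ≤ Real.exp 1 := by
        have := Real.add_one_le_exp (1 : ℝ)
        linarith
      calc (#(Λ j) : ℝ) * (2 * Real.exp (4 * l ^ 2 * #U - c j)) ≤
          (Real.exp (1 / 2 + 2 * V * (((j + 1 : ℕ) + 1) * Real.log 4)) *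
            Real.exp (1 / 2 + 2 * V * ((j + 1) * Real.log 4))) *
            (Real.exp 1 * Real.exp (4 * l ^ 2 * #U - c j)) := by
            gcongr
            exact h2.trans (mul_le_mul (h3 _) (h3 _) (hpos _).le (Real.exp_nonneg _))
        _ ≤ Real.exp 0 := by
            rw [← Real.exp_add, ← Real.exp_add, ← Real.exp_add]
            gcongr
            simp only [hc]
            push_cast
            have h5 : (V : ℝ) * (2 * j + 3) * Real.log 4 ≤ V * (2 * j + 3) * 1.4 := by gcongr
            have h6 : (0 : ℝ) ≤ V * j := by positivity
            nlinarith
        _ = 1 := Real.exp_zero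
    calc _ ≤ ∑ q ∈ Λ j, 2 ^ Fintype.card ι * (2 * Real.exp (4 * l ^ 2 * #U - c j)) :=
          sum_le_sum hq
      _ = 2 ^ Fintype.card ι * (#(Λ j) * (2 * Real.exp (4 * l ^ 2 * #U - c j))) := by
          rw [sum_const, nsmul_eq_mul]; ring
      _ ≤ 2 ^ Fintype.card ι * 1 := by gcongr
      _ = _ := mul_one _
  have hσ : ∀ σ, Real.exp (l * R σ) ≤ Real.exp (21 * V + 4 * l ^ 2 * #U) *
      ((1 / 2) ^ J + ∑ j ∈ range J, w j *
        ∑ q ∈ Λ j, Real.exp (l / w j * |S σ q.1 - S σ q.2| - c j)) := by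
    intro σ
    obtain ⟨A, hA, hRA⟩ := hR σ
    have h1 : |S σ A| ≤ ∑ j ∈ range J, |S σ (p (j + 1) A) - S σ (p j A)| := by
      have h2 : S σ A = ∑ j ∈ range J, (S σ (p (j + 1) A) - S σ (p j A)) := by
        rw [sum_range_sub (fun j => S σ (p j A)), hpJ A hA, hp0]
        simp [hS]
      rw [h2]
      exact abs_sum_le_sum_abs _ _
    set y : ℕ → ℝ := fun j => l / w j * |S σ (p (j + 1) A) - S σ (p j A)| - c j with hy
    have h2 : l * R σ ≤ (21 * V + 4 * l ^ 2 * #U) +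
        ((1 / 2 : ℝ) ^ J • 0 + ∑ j ∈ range J, w j • y j) := by
      have h3 : l * R σ ≤ l * ∑ j ∈ range J, |S σ (p (j + 1) A) - S σ (p j A)| := by
        gcongr; exact hRA.trans h1
      have h4 : ∑ j ∈ range J, w j • y j =
          l * (∑ j ∈ range J, |S σ (p (j + 1) A) - S σ (p j A)|) - ∑ j ∈ range J, w j * c j := by
        rw [mul_sum, ← sum_sub_distrib]
        refine sum_congr rfl fun j _ => ?_
        have := (hwpos j).ne'
        simp only [hy, smul_eq_mul]
        field_simp
      rw [h4, smul_zero, zero_add]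
      linarith
    -- Jensen for exp; the mass (1/2)^J missing from the weights is placed at 0. Each link of A is
    -- then bounded by the sum over all links of its level, which no longer depends on A.
    have h3 := convexOn_exp.map_add_sum_le (t := range J) (w := w) (p := y)
      (v := (1 / 2 : ℝ) ^ J) (q := 0) (fun j _ => (hwpos j).le)
      (by rw [sum_range_half_pow]; ring) (fun _ _ => Set.mem_univ _) (by positivity)
      (Set.mem_univ _)
    calc Real.exp (l * R σ) ≤ Real.exp ((21 * V + 4 * l ^ 2 * #U) +
        ((1 / 2 : ℝ) ^ J • 0 + ∑ j ∈ range J, w j • y j)) := by gcongr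
      _ = Real.exp (21 * V + 4 * l ^ 2 * #U) *
          Real.exp ((1 / 2 : ℝ) ^ J • 0 + ∑ j ∈ range J, w j • y j) := Real.exp_add _ _
      _ ≤ Real.exp (21 * V + 4 * l ^ 2 * #U) * ((1 / 2 : ℝ) ^ J • Real.exp 0 +
          ∑ j ∈ range J, w j • Real.exp (y j)) := by gcongr
      _ ≤ _ := by
          simp only [smul_eq_mul, Real.exp_zero, mul_one]
          gcongr with j _
          exact single_le_sum
            (f := fun q : Finset ι × Finset ι => Real.exp (l / w j * |S σ q.1 - S σ q.2| - c j))
            (fun q _ => Real.exp_nonneg _)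
            (mem_image_of_mem (fun A => (p (j + 1) A, p j A)) hA)
  calc ∑ σ, Real.exp (l * R σ) ≤ ∑ σ, Real.exp (21 * V + 4 * l ^ 2 * #U) *
      ((1 / 2) ^ J + ∑ j ∈ range J, w j *
        ∑ q ∈ Λ j, Real.exp (l / w j * |S σ q.1 - S σ q.2| - c j)) := sum_le_sum fun σ _ => hσ σ
    _ = Real.exp (21 * V + 4 * l ^ 2 * #U) * (2 ^ Fintype.card ι * (1 / 2) ^ J +
        ∑ j ∈ range J, w j *
          ∑ q ∈ Λ j, ∑ σ, Real.exp (l / w j * |S σ q.1 - S σ q.2| - c j)) := by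
        rw [← mul_sum, sum_add_distrib, sum_comm]
        congr 2
        · simp
        · refine sum_congr rfl fun j _ => ?_
          rw [← mul_sum, sum_comm]
    _ ≤ Real.exp (21 * V + 4 * l ^ 2 * #U) * (2 ^ Fintype.card ι * (1 / 2) ^ J +
        ∑ j ∈ range J, w j * 2 ^ Fintype.card ι) := by
        gcongr with j _
        exact hlink j
    _ = _ := by
        rw [← sum_mul, sum_range_half_pow]; ring

end Rademacher

/-! ### Symmetrization and uniform deviation of counts. -/

section Symmetrization

open Finset
open scoped ENNReal

variable {X : Type*}

open Classical in
/-- The indices of the sample points that lie in `U`. -/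
noncomputable def hitSet (U : Set X) {n : ℕ} (z : Fin n → X) : Finset (Fin n) :=
  univ.filter fun i => z i ∈ U

theorem mem_hitSet {U : Set X} {n : ℕ} {z : Fin n → X} {i : Fin n} :
    i ∈ hitSet U z ↔ z i ∈ U := by
  simp [hitSet]

theorem sum_mul_indicator {U : Set X} {n : ℕ} (z : Fin n → X) (e : Fin n → ℝ) :
    ∑ i, e i * U.indicator 1 (z i) = ∑ i ∈ hitSet U z, e i := by
  classical
  simp [hitSet, sum_filter, Set.indicator_apply]

theorem sum_indicator {U : Set X} {n : ℕ} (z : Fin n → X) :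
    ∑ i, U.indicator (1 : X → ℝ) (z i) = #(hitSet U z) := by
  simpa using sum_mul_indicator (U := U) z fun _ => 1

variable {ι : Type*}

/-- Every trace of the family of sets `c` on a finite sample shatters only index sets of
cardinality at most `V`. -/
def HasTraceDim (c : ι → Set X) (V : ℕ) : Prop :=
  ∀ (n : ℕ) (z : Fin n → X) (s : Finset (Fin n)),
    (∀ t ⊆ s, ∃ g, ∀ i ∈ s, z i ∈ c g ↔ i ∈ t) → #s ≤ V

theorem sum_exp_iSup_rademacher_le [Nonempty ι] {c : ι → Set X} {U : Set X} {V : ℕ} (hV1 : 1 ≤ V)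
    (hcU : ∀ g, c g ⊆ U) (hc : HasTraceDim c V) {n : ℕ} (z : Fin n → X) {l : ℝ} (hl : 0 ≤ l) :
    ∑ σ : Fin n → Bool,
        Real.exp (l * ⨆ g, |∑ i, boolSign (σ i) * (c g).indicator 1 (z i)|) ≤
      2 ^ n * Real.exp (21 * V + 4 * l ^ 2 * #(hitSet U z)) := by
  classical
  have h := sum_exp_rademacher_sup_le (𝒜 := univ.filter fun A => ∃ g, A = hitSet (c g) z)
    (U := hitSet U z) hV1 ?_ ?_ hl
    (fun σ => ⨆ g, |∑ i, boolSign (σ i) * (c g).indicator 1 (z i)|) ?_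
  · simpa using h
  · intro A hA i hi
    obtain ⟨g, rfl⟩ := (mem_filter.1 hA).2
    exact mem_hitSet.2 (hcU g (mem_hitSet.1 hi))
  · intro s hs
    refine hc n z s fun t ht => ?_
    obtain ⟨u, hu, hut⟩ := hs ht
    obtain ⟨g, rfl⟩ := (mem_filter.1 hu).2
    refine ⟨g, fun i hi => ?_⟩
    rw [← hut, mem_inter, mem_hitSet]
    tauto
  · intro σ
    -- The class may be infinite, but its traces on the sample are finitely many, so the supremum is
    -- attained.
    have hfin : (Set.range fun g => |∑ i, boolSign (σ i) * (c g).indicator 1 (z i)|).Finite := by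
      refine (Set.finite_range fun A : Finset (Fin n) => |∑ i ∈ A, boolSign (σ i)|).subset ?_
      rintro _ ⟨g, rfl⟩
      exact ⟨hitSet (c g) z, by simp only [sum_mul_indicator]⟩
    obtain ⟨g, hg⟩ := (Set.range_nonempty _).csSup_mem hfin
    refine ⟨hitSet (c g) z, mem_filter.2 ⟨mem_univ _, g, rfl⟩, ?_⟩
    rw [← sum_mul_indicator]
    exact hg.ge

/-- The supremum over the class of the difference of the counts of two samples. -/
noncomputable def symmSup (c : ι → Set X) {n : ℕ} (z z' : Fin n → X) : ℝ :=
  ⨆ g, |∑ i, ((c g).indicator 1 (z i) - (c g).indicator 1 (z' i))|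

theorem abs_indicator_one_le (S : Set X) (x : X) : |S.indicator (1 : X → ℝ) x| ≤ 1 := by
  by_cases h : x ∈ S <;> simp [h]

theorem abs_sum_mul_indicator_le (S : Set X) {n : ℕ} (e : Fin n → ℝ) (z : Fin n → X) :
    |∑ i, e i * S.indicator 1 (z i)| ≤ ∑ i, |e i| := by
  refine (abs_sum_le_sum_abs _ _).trans (sum_le_sum fun i _ => ?_)
  rw [abs_mul]
  exact mul_le_of_le_one_right (abs_nonneg _) (abs_indicator_one_le _ _)

theorem bddAbove_abs_sum_mul_indicator (c : ι → Set X) {n : ℕ} (e : Fin n → ℝ) (z : Fin n → X) :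
    BddAbove (Set.range fun g => |∑ i, e i * (c g).indicator 1 (z i)|) := by
  refine ⟨∑ i, |e i|, ?_⟩
  rintro _ ⟨g, rfl⟩
  exact abs_sum_mul_indicator_le _ _ _

theorem le_symmSup (c : ι → Set X) {n : ℕ} (z z' : Fin n → X) (g : ι) :
    |∑ i, ((c g).indicator 1 (z i) - (c g).indicator 1 (z' i))| ≤ symmSup c z z' := by
  refine le_ciSup (f := fun g => |∑ i, ((c g).indicator 1 (z i) - (c g).indicator 1 (z' i))|)
    ⟨∑ _i : Fin n, 2, ?_⟩ g
  rintro _ ⟨g, rfl⟩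
  refine (abs_sum_le_sum_abs _ _).trans (sum_le_sum fun i _ => ?_)
  refine (abs_sub _ _).trans ?_
  have h1 := abs_indicator_one_le (c g) (z i)
  have h2 := abs_indicator_one_le (c g) (z' i)
  linarith

/-- Exchange the two members of the `i`-th pair if `σ i` is false. -/
def swapPairs {n : ℕ} (σ : Fin n → Bool) (w : Fin n → X × X) : Fin n → X × X :=
  fun i => if σ i then w i else (w i).swap

/-- A swap flips the sign of one summand, so the supremum is at most the sum of a Rademacher
supremum for each half. The inequality exp(a + b) ≤ (exp(2a) + exp(2b))/2 separates them, turning l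
into 2l and hence 4l² into 16l². -/
theorem sum_exp_symmSup_swapPairs_le [Nonempty ι] {c : ι → Set X} {U : Set X} {V : ℕ}
    (hV1 : 1 ≤ V) (hcU : ∀ g, c g ⊆ U) (hc : HasTraceDim c V) {n : ℕ} (w : Fin n → X × X)
    {l : ℝ} (hl : 0 ≤ l) :
    ∑ σ : Fin n → Bool, Real.exp (l * symmSup c (fun i => (swapPairs σ w i).1)
        fun i => (swapPairs σ w i).2) ≤
      2 ^ n * (Real.exp (21 * V + 16 * l ^ 2 * #(hitSet U fun i => (w i).1)) / 2 +
        Real.exp (21 * V + 16 * l ^ 2 * #(hitSet U fun i => (w i).2)) / 2) := by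
  have h1 := sum_exp_iSup_rademacher_le hV1 hcU hc (fun i => (w i).1) (l := 2 * l) (by positivity)
  have h2 := sum_exp_iSup_rademacher_le hV1 hcU hc (fun i => (w i).2) (l := 2 * l) (by positivity)
  rw [show 4 * (2 * l) ^ 2 = 16 * l ^ 2 by ring] at h1 h2
  set R : (Fin n → X) → (Fin n → Bool) → ℝ := fun z σ =>
    ⨆ g, |∑ i, boolSign (σ i) * (c g).indicator 1 (z i)| with hR
  have key : ∀ σ : Fin n → Bool, Real.exp (l * symmSup c (fun i => (swapPairs σ w i).1)
      fun i => (swapPairs σ w i).2) ≤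
      Real.exp (2 * l * R (fun i => (w i).1) σ) / 2 +
        Real.exp (2 * l * R (fun i => (w i).2) σ) / 2 := by
    intro σ
    have h3 : symmSup c (fun i => (swapPairs σ w i).1) (fun i => (swapPairs σ w i).2) ≤
        R (fun i => (w i).1) σ + R (fun i => (w i).2) σ := by
      refine ciSup_le fun g => ?_
      have h4 : ∑ i, ((c g).indicator 1 (swapPairs σ w i).1 -
          (c g).indicator (1 : X → ℝ) (swapPairs σ w i).2) =
          ∑ i, boolSign (σ i) * (c g).indicator 1 (w i).1 -
            ∑ i, boolSign (σ i) * (c g).indicator 1 (w i).2 := by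
        rw [← sum_sub_distrib]
        refine sum_congr rfl fun i _ => ?_
        cases h : σ i <;> simp [swapPairs, boolSign, h]
        ring
      rw [h4]
      refine (abs_sub _ _).trans (add_le_add ?_ ?_)
      · exact le_ciSup (bddAbove_abs_sum_mul_indicator c (fun i => boolSign (σ i))
          fun i => (w i).1) g
      · exact le_ciSup (bddAbove_abs_sum_mul_indicator c (fun i => boolSign (σ i))
          fun i => (w i).2) g
    set a := R (fun i => (w i).1) σ
    set b := R (fun i => (w i).2) σ
    have h5 : Real.exp (l * a + l * b) ≤ Real.exp (2 * l * a) / 2 + Real.exp (2 * l * b) / 2 := by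
      rw [show 2 * l * a = l * a + l * a by ring, show 2 * l * b = l * b + l * b by ring,
        Real.exp_add, Real.exp_add, Real.exp_add]
      nlinarith [sq_nonneg (Real.exp (l * a) - Real.exp (l * b))]
    refine le_trans (Real.exp_le_exp.2 ?_) h5
    rw [← mul_add]
    gcongr
  refine (sum_le_sum fun σ _ => key σ).trans ?_
  rw [sum_add_distrib, ← sum_div, ← sum_div, mul_add, mul_div_assoc', mul_div_assoc']
  gcongr

variable [MeasurableSpace X] {μ : Measure X} [IsProbabilityMeasure μ]

/-- Measurability of the weighted suprema on the completed product spaces. -/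
def HasMeasurableSup (μ : Measure X) (c : ι → Set X) : Prop :=
  ∀ (m : ℕ) (e : Fin m → ℝ),
    AEMeasurable (fun z : Fin m → X => ⨆ g, |∑ i, e i * (c g).indicator 1 (z i)|)
      (Measure.pi fun _ => μ)

/-- A pair of samples is one sample of size n + n, so `HasMeasurableSup` with weights 1 and -1
covers `symmSup`. -/
theorem measurePreserving_append (μ : Measure X) [IsProbabilityMeasure μ] (n : ℕ) :
    MeasurePreserving (fun q : (Fin n → X) × (Fin n → X) => Fin.append q.1 q.2)
      ((Measure.pi fun _ => μ).prod (Measure.pi fun _ => μ))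
      (Measure.pi fun _ : Fin (n + n) => μ) := by
  have h1 := measurePreserving_sumPiEquivProdPi_symm (X := fun _ : Fin n ⊕ Fin n => X) fun _ => μ
  have h2 := measurePreserving_piCongrLeft (α := fun _ : Fin (n + n) => X) (fun _ => μ)
    (finSumFinEquiv (m := n) (n := n))
  convert h2.comp h1 using 1
  funext q i
  refine Fin.addCases (fun j => ?_) (fun j => ?_) i
  · have := Equiv.piCongrLeft_apply_apply (P := fun _ : Fin (n + n) => X)
      (finSumFinEquiv (m := n) (n := n)) ((MeasurableEquiv.sumPiEquivProdPi
        (fun _ : Fin n ⊕ Fin n => X)).symm q) (Sum.inl j)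
    simp only [finSumFinEquiv_apply_left] at this
    simp only [Fin.append_left, Function.comp, MeasurableEquiv.coe_piCongrLeft]
    rw [this]
    rfl
  · have := Equiv.piCongrLeft_apply_apply (P := fun _ : Fin (n + n) => X)
      (finSumFinEquiv (m := n) (n := n)) ((MeasurableEquiv.sumPiEquivProdPi
        (fun _ : Fin n ⊕ Fin n => X)).symm q) (Sum.inr j)
    simp only [finSumFinEquiv_apply_right] at this
    simp only [Fin.append_right, Function.comp, MeasurableEquiv.coe_piCongrLeft]
    rw [this]
    rfl

theorem HasMeasurableSup.aemeasurable_symmSup {c : ι → Set X} (hM : HasMeasurableSup μ c)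
    (n : ℕ) :
    AEMeasurable (fun q : (Fin n → X) × (Fin n → X) => symmSup c q.1 q.2)
      ((Measure.pi fun _ => μ).prod (Measure.pi fun _ => μ)) := by
  have hp := measurePreserving_append μ n
  have h := hM (n + n) (Fin.append (fun _ => 1) fun _ => -1)
  rw [← hp.map_eq] at h
  have h2 := h.comp_measurable hp.measurable
  refine h2.congr (Filter.Eventually.of_forall fun q => ?_)
  simp only [Function.comp, symmSup, Fin.sum_univ_add, Fin.append_left, Fin.append_right,
    one_mul, neg_mul, sum_neg_distrib, ← sub_eq_add_neg, sum_sub_distrib]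

theorem measurePreserving_swapPairs (μ : Measure X) [IsProbabilityMeasure μ] {n : ℕ}
    (σ : Fin n → Bool) :
    MeasurePreserving (swapPairs (X := X) σ) (Measure.pi fun _ => μ.prod μ)
      (Measure.pi fun _ => μ.prod μ) := by
  refine measurePreserving_pi (fun _ => μ.prod μ) (fun _ => μ.prod μ)
    (f := fun i p => if σ i then p else p.swap) fun i => ?_
  cases h : σ i
  · simpa using Measure.measurePreserving_swap
  · exact MeasurePreserving.id _

theorem measurable_card_hitSet {U : Set X} (hU : MeasurableSet U) (n : ℕ) :
    Measurable fun z : Fin n → X => (#(hitSet U z) : ℝ) := by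
  simp only [← sum_indicator]
  refine Finset.measurable_sum _ fun i _ => ?_
  exact (measurable_one.indicator hU).comp (measurable_pi_apply i)

/-- Every swap preserves the law of the pairs, so the integral equals its average over all swaps,
which is bounded pointwise; the two halves have the same law. -/
theorem lintegral_exp_symmSup_le [Nonempty ι] {c : ι → Set X} {U : Set X} {V : ℕ} (hV1 : 1 ≤ V)
    (hU : MeasurableSet U) (hcU : ∀ g, c g ⊆ U) (hc : HasTraceDim c V)
    (hM : HasMeasurableSup μ c) (n : ℕ) {l : ℝ} (hl : 0 ≤ l) :
    ∫⁻ q, ENNReal.ofReal (Real.exp (l * symmSup c q.1 q.2))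
        ∂(Measure.pi fun _ : Fin n => μ).prod (Measure.pi fun _ => μ) ≤
      ∫⁻ z, ENNReal.ofReal (Real.exp (21 * V + 16 * l ^ 2 * #(hitSet U z)))
        ∂Measure.pi fun _ : Fin n => μ := by
  set e := MeasurableEquiv.arrowProdEquivProdArrow X X (Fin n)
  have he : MeasurePreserving e (Measure.pi fun _ => μ.prod μ)
      ((Measure.pi fun _ => μ).prod (Measure.pi fun _ => μ)) :=
    measurePreserving_arrowProdEquivProdArrow X X (Fin n) (fun _ => μ) fun _ => μ
  have hS := hM.aemeasurable_symmSup n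
  have hF : AEMeasurable (fun w : Fin n → X × X => ENNReal.ofReal (Real.exp (l *
      symmSup c (fun i => (w i).1) fun i => (w i).2))) (Measure.pi fun _ => μ.prod μ) := by
    have h1 : AEMeasurable (fun w : Fin n → X × X => symmSup c (fun i => (w i).1)
        fun i => (w i).2) (Measure.pi fun _ => μ.prod μ) := by
      rw [← he.map_eq] at hS
      exact hS.comp_measurable he.measurable
    exact (Real.measurable_exp.comp_aemeasurable (h1.const_mul l)).ennreal_ofReal
  set F : (Fin n → X × X) → ℝ≥0∞ := fun w => ENNReal.ofReal (Real.exp (l *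
      symmSup c (fun i => (w i).1) fun i => (w i).2)) with hFdef
  set B : (Fin n → X) → ℝ≥0∞ := fun z =>
    ENNReal.ofReal (Real.exp (21 * V + 16 * l ^ 2 * #(hitSet U z))) with hBdef
  have hB : Measurable B :=
    (Real.measurable_exp.comp
      (((measurable_card_hitSet hU n).const_mul _).const_add _)).ennreal_ofReal
  have h0 : ∫⁻ q, ENNReal.ofReal (Real.exp (l * symmSup c q.1 q.2))
      ∂(Measure.pi fun _ : Fin n => μ).prod (Measure.pi fun _ => μ) =
      ∫⁻ w, F w ∂Measure.pi fun _ => μ.prod μ := by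
    rw [he.lintegral_map_equiv _ e]
    rfl
  have hsw : ∀ σ : Fin n → Bool, AEMeasurable (fun w => F (swapPairs σ w))
      (Measure.pi fun _ => μ.prod μ) ∧ ∫⁻ w, F (swapPairs σ w) ∂Measure.pi (fun _ => μ.prod μ) =
        ∫⁻ w, F w ∂Measure.pi fun _ => μ.prod μ := by
    intro σ
    have hp := measurePreserving_swapPairs μ σ
    have hF' := hF
    rw [← hp.map_eq] at hF'
    refine ⟨hF'.comp_measurable hp.measurable, ?_⟩
    conv_rhs => rw [← hp.map_eq]
    rw [lintegral_map' hF' hp.measurable.aemeasurable]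
  have hfst : MeasurePreserving (fun (w : Fin n → X × X) i => (w i).1)
      (Measure.pi fun _ => μ.prod μ) (Measure.pi fun _ => μ) :=
    measurePreserving_pi (fun _ => μ.prod μ) (fun _ => μ) fun _ => measurePreserving_fst
  have hsnd : MeasurePreserving (fun (w : Fin n → X × X) i => (w i).2)
      (Measure.pi fun _ => μ.prod μ) (Measure.pi fun _ => μ) :=
    measurePreserving_pi (fun _ => μ.prod μ) (fun _ => μ) fun _ => measurePreserving_snd
  have hpt : ∀ w, ∑ σ : Fin n → Bool, F (swapPairs σ w) ≤
      2 ^ n * (B (fun i => (w i).1) / 2 + B (fun i => (w i).2) / 2) := by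
    intro w
    have h := sum_exp_symmSup_swapPairs_le hV1 hcU hc w hl
    have h' := ENNReal.ofReal_le_ofReal h
    rw [ENNReal.ofReal_sum_of_nonneg fun _ _ => Real.exp_nonneg _,
      ENNReal.ofReal_mul (by positivity), ENNReal.ofReal_add (by positivity) (by positivity),
      ENNReal.ofReal_div_of_pos two_pos, ENNReal.ofReal_div_of_pos two_pos,
      ENNReal.ofReal_pow zero_le_two, ENNReal.ofReal_ofNat] at h'
    exact h'
  have hsum : (2 : ℝ≥0∞) ^ n * ∫⁻ w, F w ∂Measure.pi (fun _ => μ.prod μ) ≤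
      2 ^ n * ∫⁻ z, B z ∂Measure.pi fun _ => μ := by
    calc (2 : ℝ≥0∞) ^ n * ∫⁻ w, F w ∂Measure.pi (fun _ => μ.prod μ) =
        ∑ σ : Fin n → Bool, ∫⁻ w, F (swapPairs σ w) ∂Measure.pi (fun _ => μ.prod μ) := by
          simp [(hsw _).2]
      _ = ∫⁻ w, ∑ σ : Fin n → Bool, F (swapPairs σ w) ∂Measure.pi (fun _ => μ.prod μ) :=
          (lintegral_finsetSum' _ fun σ _ => (hsw σ).1).symm
      _ ≤ ∫⁻ w, 2 ^ n * (B (fun i => (w i).1) / 2 + B (fun i => (w i).2) / 2)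
            ∂Measure.pi (fun _ => μ.prod μ) := lintegral_mono hpt
      _ = 2 ^ n * ∫⁻ z, B z ∂Measure.pi fun _ => μ := by
          have h1 : Measurable fun w : Fin n → X × X => B (fun i => (w i).1) / 2 :=
            (hB.comp hfst.measurable).div_const 2
          have h2 : Measurable fun w : Fin n → X × X => B (fun i => (w i).2) / 2 :=
            (hB.comp hsnd.measurable).div_const 2
          have h12 : Measurable fun w : Fin n → X × X =>
              B (fun i => (w i).1) / 2 + B (fun i => (w i).2) / 2 := h1.add h2
          rw [lintegral_const_mul _ h12, lintegral_add_left h1,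
            hfst.lintegral_comp (f := fun z => B z / 2) (hB.div_const 2),
            hsnd.lintegral_comp (f := fun z => B z / 2) (hB.div_const 2)]
          simp only [div_eq_mul_inv]
          rw [lintegral_mul_const _ hB, ← mul_add, ENNReal.inv_two_add_inv_two, mul_one]
  rw [h0]
  exact (ENNReal.mul_le_mul_iff_right (by positivity) (by finiteness)).1 hsum

/-- The count is binomial, with moment generating function (1 + p(exp θ - 1))ⁿ. -/
theorem lintegral_exp_card_hitSet_le {U : Set X} (hU : MeasurableSet U) (n : ℕ) (θ : ℝ) :
    ∫⁻ z, ENNReal.ofReal (Real.exp (θ * #(hitSet U z))) ∂Measure.pi (fun _ : Fin n => μ) ≤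
      ENNReal.ofReal (Real.exp (n * μ.real U * (Real.exp θ - 1))) := by
  have hprod : ∀ z : Fin n → X, Real.exp (θ * #(hitSet U z)) =
      ∏ i, Real.exp (θ * U.indicator 1 (z i)) := by
    intro z
    rw [← sum_indicator, mul_sum, Real.exp_sum]
  have hpt : ∀ x, Real.exp (θ * U.indicator 1 x) = 1 + U.indicator (fun _ => Real.exp θ - 1) x := by
    intro x
    by_cases h : x ∈ U <;> simp [h]
  have hint : Integrable (fun x => U.indicator (fun _ => Real.exp θ - 1) x) μ :=
    (integrable_const _).indicator hU
  have hint' : Integrable (fun x => Real.exp (θ * U.indicator 1 x)) μ := by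
    simp only [hpt]
    exact (integrable_const _).add hint
  have h1 : ∫ x, Real.exp (θ * U.indicator 1 x) ∂μ = 1 + μ.real U * (Real.exp θ - 1) := by
    simp only [hpt]
    rw [integral_add (integrable_const _) hint, integral_indicator_const _ hU]
    simp
  have h2 : Integrable (fun z : Fin n → X => ∏ i, Real.exp (θ * U.indicator 1 (z i)))
      (Measure.pi fun _ => μ) := Integrable.fintype_prod fun _ => hint'
  simp only [hprod]
  rw [← ofReal_integral_eq_lintegral_ofReal h2
    (Filter.Eventually.of_forall fun z => by positivity)]
  refine ENNReal.ofReal_le_ofReal ?_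
  have h3 := integral_fintype_prod_eq_pow (ι := Fin n) (μ := μ)
    fun x => Real.exp (θ * U.indicator 1 x)
  rw [h3, h1, Fintype.card_fin]
  have h4 : 0 ≤ 1 + μ.real U * (Real.exp θ - 1) := by
    rw [← h1]; exact integral_nonneg fun _ => Real.exp_nonneg _
  calc (1 + μ.real U * (Real.exp θ - 1)) ^ n ≤ Real.exp (μ.real U * (Real.exp θ - 1)) ^ n := by
        gcongr
        rw [add_comm]
        exact Real.add_one_le_exp _
    _ = _ := by rw [← Real.exp_nat_mul]; ring_nf

theorem exp_integral_le_lintegral_exp {Y : Type*} [MeasurableSpace Y] {ν : Measure Y}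
    [IsProbabilityMeasure ν] {f : Y → ℝ} (hf : Measurable f) {b : ℝ} (hb : ∀ y, |f y| ≤ b) :
    ENNReal.ofReal (Real.exp (∫ y, f y ∂ν)) ≤ ∫⁻ y, ENNReal.ofReal (Real.exp (f y)) ∂ν := by
  have h1 : Integrable f ν := Integrable.of_bound hf.aestronglyMeasurable b
    (Filter.Eventually.of_forall hb)
  have h2 : Integrable (fun y => Real.exp (f y)) ν :=
    Integrable.of_bound (Real.measurable_exp.comp hf).aestronglyMeasurable (Real.exp b)
      (Filter.Eventually.of_forall fun y => by
        rw [Real.norm_eq_abs, Real.abs_exp]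
        exact Real.exp_le_exp.2 ((le_abs_self _).trans (hb y)))
  have h3 := convexOn_exp.map_integral_le (μ := ν) (f := f) Real.continuous_exp.continuousOn
    isClosed_univ (Filter.Eventually.of_forall fun _ => Set.mem_univ _) h1 h2
  rw [← ofReal_integral_eq_lintegral_ofReal h2
    (Filter.Eventually.of_forall fun y => Real.exp_nonneg _)]
  exact ENNReal.ofReal_le_ofReal h3

/-- The mean is an integral over a ghost sample, and Jensen takes that integral out of exp. The
right side does not depend on g, so it dominates all deviations at once. -/
theorem exp_abs_deviation_le {c : ι → Set X} (hcm : ∀ g, MeasurableSet (c g)) {n : ℕ}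
    (z : Fin n → X) (g : ι) {l : ℝ} (hl : 0 ≤ l) :
    ENNReal.ofReal (Real.exp (l * |(#(hitSet (c g) z) : ℝ) - n * μ.real (c g)|)) ≤
      ∫⁻ z', ENNReal.ofReal (Real.exp (l * symmSup c z z')) ∂Measure.pi fun _ => μ := by
  have hmeas := measurable_card_hitSet (hcm g) n
  have hbd : ∀ z' : Fin n → X, |(#(hitSet (c g) z') : ℝ)| ≤ n := by
    intro z'
    rw [Nat.abs_cast]
    have := card_le_univ (hitSet (c g) z')
    rw [Fintype.card_fin] at this
    exact_mod_cast this
  have hint : Integrable (fun z' : Fin n → X => (#(hitSet (c g) z') : ℝ))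
      (Measure.pi fun _ => μ) :=
    Integrable.of_bound hmeas.aestronglyMeasurable n (Filter.Eventually.of_forall hbd)
  have hmean : ∫ z', (#(hitSet (c g) z') : ℝ) ∂Measure.pi (fun _ : Fin n => μ) =
      n * μ.real (c g) := by
    simp only [← sum_indicator]
    have hI : Integrable ((c g).indicator (1 : X → ℝ)) μ :=
      (integrable_const (1 : ℝ)).indicator (hcm g)
    rw [integral_finsetSum]
    · have : ∀ i : Fin n, ∫ z' : Fin n → X, (c g).indicator (1 : X → ℝ) (z' i)
          ∂Measure.pi (fun _ : Fin n => μ) = μ.real (c g) := by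
        intro i
        have hp := measurePreserving_eval (fun _ : Fin n => μ) i
        have := integral_map (μ := Measure.pi fun _ : Fin n => μ) hp.measurable.aemeasurable
          (f := (c g).indicator (1 : X → ℝ))
          (by rw [hp.map_eq]; exact hI.aestronglyMeasurable)
        rw [hp.map_eq] at this
        rw [← integral_indicator_one (hcm g), this]
      simp [this]
    · intro i _
      exact (measurePreserving_eval (fun _ : Fin n => μ) i).integrable_comp_of_integrable hI
  have hs : ∀ s : ℝ, |s| = l →
      ENNReal.ofReal (Real.exp (s * ((#(hitSet (c g) z) : ℝ) - n * μ.real (c g)))) ≤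
      ∫⁻ z', ENNReal.ofReal (Real.exp (l * symmSup c z z')) ∂Measure.pi fun _ => μ := by
    intro s hs
    have h1 : s * ((#(hitSet (c g) z) : ℝ) - n * μ.real (c g)) =
        ∫ z', s * ((#(hitSet (c g) z) : ℝ) - #(hitSet (c g) z'))
          ∂Measure.pi (fun _ : Fin n => μ) := by
      rw [integral_const_mul, integral_sub (integrable_const _) hint, hmean]
      simp
    rw [h1]
    refine (exp_integral_le_lintegral_exp ((hmeas.const_sub _).const_mul s) (b := l * (n + n))
      fun z' => ?_).trans (lintegral_mono fun z' => ENNReal.ofReal_le_ofReal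
        (Real.exp_le_exp.2 ?_))
    · rw [abs_mul, hs]
      gcongr
      exact (abs_sub _ _).trans (add_le_add (hbd z) (hbd z'))
    · have h2 := le_symmSup c z z' g
      rw [sum_sub_distrib, sum_indicator, sum_indicator] at h2
      refine (le_abs_self _).trans ?_
      rw [abs_mul, hs]
      gcongr
  rcases abs_cases ((#(hitSet (c g) z) : ℝ) - n * μ.real (c g)) with h | h
  · rw [h.1]; exact hs l (abs_of_nonneg hl)
  · rw [h.1, mul_neg, ← neg_mul]; exact hs (-l) (by rw [abs_neg, abs_of_nonneg hl])

/-- Uniform deviation of the counts over a class of sets of finite VC dimension contained in `U`,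
together with the deviation of the count of `U` itself. -/
theorem measure_deviation_le [Nonempty ι] {c : ι → Set X} {U : Set X} {V : ℕ} (hV1 : 1 ≤ V)
    (hU : MeasurableSet U) (hcm : ∀ g, MeasurableSet (c g)) (hcU : ∀ g, c g ⊆ U)
    (hc : HasTraceDim c V) (hM : HasMeasurableSup μ c) (n : ℕ) {l δ : ℝ} (hl : 0 ≤ l)
    (hl1 : 4 * l ≤ 1) (hδ : 0 < δ) :
    (Measure.pi fun _ : Fin n => μ) {z | ¬ ((∀ g, l * |(#(hitSet (c g) z) : ℝ) - n * μ.real (c g)| ≤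
        21 * V + 32 * l ^ 2 * (n * μ.real U) + Real.log (3 / δ)) ∧
      l * |(#(hitSet U z) : ℝ) - n * μ.real U| ≤
        21 * V + 32 * l ^ 2 * (n * μ.real U) + Real.log (3 / δ))} ≤ ENNReal.ofReal δ := by
  set D : ℝ := 21 * V + 32 * l ^ 2 * (n * μ.real U) with hD
  set N : (Fin n → X) → ℝ := fun z => #(hitSet U z) with hN
  have hNm : Measurable N := measurable_card_hitSet hU n
  have hp : 0 ≤ n * μ.real U := by positivity
  -- Markov's inequality is applied to this almost everywhere measurable majorant, so the supremum
  -- of the deviations need not be measurable.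
  set K : (Fin n → X) → ℝ≥0∞ := fun z =>
    ∫⁻ z', ENNReal.ofReal (Real.exp (l * symmSup c z z')) ∂Measure.pi fun _ => μ with hK
  have hSm : AEMeasurable (fun q : (Fin n → X) × (Fin n → X) =>
      ENNReal.ofReal (Real.exp (l * symmSup c q.1 q.2)))
      ((Measure.pi fun _ => μ).prod (Measure.pi fun _ => μ)) :=
    (Real.measurable_exp.comp_aemeasurable
      ((hM.aemeasurable_symmSup n).const_mul l)).ennreal_ofReal
  have hKm : AEMeasurable K (Measure.pi fun _ => μ) := hSm.lintegral_prod_right'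
  have hKi : ∫⁻ z, K z ∂Measure.pi (fun _ => μ) ≤ ENNReal.ofReal (Real.exp D) := by
    rw [← lintegral_prod _ hSm]
    refine (lintegral_exp_symmSup_le hV1 hU hcU hc hM n hl).trans ?_
    simp only [Real.exp_add, ENNReal.ofReal_mul (Real.exp_nonneg _)]
    have hm : Measurable fun z : Fin n → X =>
        ENNReal.ofReal (Real.exp (16 * l ^ 2 * #(hitSet U z))) :=
      (Real.measurable_exp.comp (hNm.const_mul _)).ennreal_ofReal
    rw [lintegral_const_mul _ hm, hD,
      Real.exp_add, ENNReal.ofReal_mul (Real.exp_nonneg _)]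
    gcongr
    refine (lintegral_exp_card_hitSet_le hU n (16 * l ^ 2)).trans ?_
    refine ENNReal.ofReal_le_ofReal (Real.exp_le_exp.2 ?_)
    -- On this range exp(16l²) - 1 ≤ 32l²; this is where 4l ≤ 1 enters.
    have h16 : |16 * l ^ 2| ≤ 1 := by
      rw [abs_of_nonneg (by positivity)]
      nlinarith
    have h1 := (le_abs_self _).trans (Real.abs_exp_sub_one_le h16)
    rw [abs_of_nonneg (by positivity)] at h1
    have h2 := mul_le_mul_of_nonneg_left h1 hp
    linarith
  have hNi : ∀ s : ℝ, |s| = l → ∫⁻ z, ENNReal.ofReal (Real.exp (s * (N z - n * μ.real U)))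
      ∂Measure.pi (fun _ => μ) ≤ ENNReal.ofReal (Real.exp D) := by
    intro s hs
    have h1 : ∀ z, ENNReal.ofReal (Real.exp (s * (N z - n * μ.real U))) =
        ENNReal.ofReal (Real.exp (s * N z)) * ENNReal.ofReal (Real.exp (-(s * (n * μ.real U)))) := by
      intro z
      rw [← ENNReal.ofReal_mul (Real.exp_nonneg _), ← Real.exp_add]
      ring_nf
    simp only [h1]
    have hm : Measurable fun z => ENNReal.ofReal (Real.exp (s * N z)) :=
      (Real.measurable_exp.comp (hNm.const_mul s)).ennreal_ofReal
    rw [lintegral_mul_const _ hm]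
    refine (mul_le_mul_left (lintegral_exp_card_hitSet_le hU n s) _).trans ?_
    rw [← ENNReal.ofReal_mul (Real.exp_nonneg _), ← Real.exp_add]
    gcongr
    have h2 := (le_abs_self _).trans (Real.abs_exp_sub_one_sub_id_le (x := s) (by linarith))
    rw [← sq_abs s, hs] at h2
    have hV0 : (0 : ℝ) ≤ V := by positivity
    have h3 := mul_le_mul_of_nonneg_left h2 hp
    have h4 : 0 ≤ l ^ 2 * (n * μ.real U) := by positivity
    rw [hD]
    nlinarith
  -- Three exponentials, each of integral at most exp D, whence log(3/δ).
  set Q : (Fin n → X) → ℝ≥0∞ := fun z => K z +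
    (ENNReal.ofReal (Real.exp (l * (N z - n * μ.real U))) +
      ENNReal.ofReal (Real.exp (-l * (N z - n * μ.real U)))) with hQ
  have hEm : ∀ s : ℝ, Measurable fun z => ENNReal.ofReal (Real.exp (s * (N z - n * μ.real U))) :=
    fun s => (Real.measurable_exp.comp ((hNm.sub_const _).const_mul s)).ennreal_ofReal
  have hQm : AEMeasurable Q (Measure.pi fun _ => μ) :=
    hKm.add ((hEm l).add (hEm (-l))).aemeasurable
  have hQi : ∫⁻ z, Q z ∂Measure.pi (fun _ => μ) ≤ ENNReal.ofReal (3 * Real.exp D) := by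
    have hm : Measurable fun z => ENNReal.ofReal (Real.exp (l * (N z - n * μ.real U))) +
        ENNReal.ofReal (Real.exp (-l * (N z - n * μ.real U))) := (hEm l).add (hEm (-l))
    rw [lintegral_add_right _ hm, lintegral_add_left (hEm l)]
    refine (add_le_add hKi (add_le_add (hNi l (abs_of_nonneg hl))
      (hNi (-l) (by rw [abs_neg, abs_of_nonneg hl])))).trans_eq ?_
    rw [← ENNReal.ofReal_add (by positivity) (by positivity),
      ← ENNReal.ofReal_add (by positivity) (by positivity)]
    ring_nf
  set ε : ℝ := Real.exp (D + Real.log (3 / δ)) with hε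
  have hsub : {z | ¬ ((∀ g, l * |(#(hitSet (c g) z) : ℝ) - n * μ.real (c g)| ≤
        D + Real.log (3 / δ)) ∧ l * |(#(hitSet U z) : ℝ) - n * μ.real U| ≤
        D + Real.log (3 / δ))} ⊆ {z | ENNReal.ofReal ε ≤ Q z} := by
    intro z hz
    simp only [Set.mem_ofPred_eq, not_and_or, not_forall, not_le] at hz ⊢
    rcases hz with ⟨g, hg⟩ | hg
    · refine (ENNReal.ofReal_le_ofReal (Real.exp_le_exp.2 hg.le)).trans ?_
      exact (exp_abs_deviation_le hcm z g hl).trans le_self_add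
    · refine (ENNReal.ofReal_le_ofReal (Real.exp_le_exp.2 hg.le)).trans ?_
      refine le_trans ?_ le_add_self
      rcases abs_cases ((#(hitSet U z) : ℝ) - n * μ.real U) with h | h
      · rw [h.1]; exact le_self_add
      · rw [h.1, mul_neg, ← neg_mul]; exact le_add_self
  refine (measure_mono hsub).trans ?_
  have hmk := (mul_meas_ge_le_lintegral₀ hQm (ENNReal.ofReal ε)).trans hQi
  have hεe : 3 * Real.exp D = ε * δ := by
    rw [hε, Real.exp_add D, Real.exp_log (by positivity)]
    field_simp
  rw [hεe, ENNReal.ofReal_mul (Real.exp_nonneg _)] at hmk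
  exact (ENNReal.mul_le_mul_iff_right (by simpa using Real.exp_pos _) (by finiteness)).1 hmk

end Symmetrization

/-! ### Counting above an order statistic. -/

section OrderStatistics

open Finset

theorem orderStat_of_le {n : ℕ} (v : Fin n → ℝ) {k : ℕ} (h1 : 1 ≤ k) (h2 : k ≤ n) :
    orderStat v k = v (Tuple.sort (fun i => -v i) ⟨k - 1, by omega⟩) := by
  simp [orderStat, h1, h2]

theorem sort_neg_antitone {n : ℕ} (v : Fin n → ℝ) {i j : Fin n} (hij : i ≤ j) :
    v (Tuple.sort (fun i => -v i) j) ≤ v (Tuple.sort (fun i => -v i) i) := by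
  have := Tuple.monotone_sort (fun i => -v i) hij
  simpa using this

theorem card_orderStat_lt {n : ℕ} (v : Fin n → ℝ) {k : ℕ} (h1 : 1 ≤ k) (h2 : k ≤ n) :
    #(univ.filter fun i => orderStat v k < v i) + 1 ≤ k := by
  have hsub : univ.filter (fun i => orderStat v k < v i) ⊆
      (Iio (⟨k - 1, by omega⟩ : Fin n)).image (Tuple.sort fun i => -v i) := by
    intro i hi
    rw [mem_filter, orderStat_of_le v h1 h2] at hi
    refine mem_image.2 ⟨(Tuple.sort fun i => -v i).symm i, mem_Iio.2 ?_, by simp⟩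
    by_contra hcon
    have := sort_neg_antitone v (not_lt.1 hcon)
    rw [Equiv.apply_symm_apply] at this
    linarith [hi.2]
  have := (card_le_card hsub).trans card_image_le
  rw [Fin.card_Iio] at this
  simp only at this
  omega

theorem le_card_orderStat_le {n : ℕ} (v : Fin n → ℝ) {k : ℕ} (h1 : 1 ≤ k) (h2 : k ≤ n) :
    k ≤ #(univ.filter fun i => orderStat v k ≤ v i) := by
  have hsub : (Iic (⟨k - 1, by omega⟩ : Fin n)).image (Tuple.sort fun i => -v i) ⊆
      univ.filter (fun i => orderStat v k ≤ v i) := by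
    intro i hi
    obtain ⟨j, hj, rfl⟩ := mem_image.1 hi
    rw [mem_filter, orderStat_of_le v h1 h2]
    exact ⟨mem_univ _, sort_neg_antitone v (mem_Iic.1 hj)⟩
  have := card_le_card hsub
  rw [card_image_of_injective _ (Equiv.injective _), Fin.card_Iic] at this
  simp only at this
  omega

/-- Ties matter only at the level of the order statistic, which `ht` places in the tie-free range.
-/
theorem le_card_orderStat_lt {n : ℕ} (v : Fin n → ℝ) {k : ℕ} (h1 : 1 ≤ k) (h2 : k ≤ n) {t : ℝ}
    (hties : ∀ i j, v i = v j → t ≤ v i → i = j) (ht : t ≤ orderStat v k) :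
    k ≤ #(univ.filter fun i => orderStat v k < v i) + 1 := by
  refine (le_card_orderStat_le v h1 h2).trans ?_
  have hsub : univ.filter (fun i => orderStat v k ≤ v i) ⊆
      insert (Tuple.sort (fun i => -v i) ⟨k - 1, by omega⟩)
        (univ.filter fun i => orderStat v k < v i) := by
    intro i hi
    rw [mem_filter] at hi
    rw [mem_insert, mem_filter]
    rcases hi.2.eq_or_lt with h | h
    · left
      refine hties _ _ ?_ (h ▸ ht)
      rw [← h, orderStat_of_le v h1 h2]
    · exact Or.inr ⟨mem_univ _, h⟩
  exact (card_le_card hsub).trans (card_insert_le _ _)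

/-- Both differences count indices with values between the thresholds; imposing p only discards
some. -/
theorem abs_card_sub_card_le {n : ℕ} (v : Fin n → ℝ) (p : Fin n → Prop) [DecidablePred p]
    (a b : ℝ) :
    |(#(univ.filter fun i => p i ∧ a < v i) : ℝ) - #(univ.filter fun i => p i ∧ b < v i)| ≤
      |(#(univ.filter fun i => a < v i) : ℝ) - #(univ.filter fun i => b < v i)| := by
  wlog hab : a ≤ b generalizing a b
  · rw [abs_sub_comm, abs_sub_comm (#(univ.filter fun i => a < v i) : ℝ)]
    exact this b a (le_of_not_ge hab)
  have hP : univ.filter (fun i => p i ∧ b < v i) ⊆ univ.filter fun i => p i ∧ a < v i :=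
    fun i hi => by
      rw [mem_filter] at hi ⊢
      exact ⟨hi.1, hi.2.1, hab.trans_lt hi.2.2⟩
  have hA : univ.filter (fun i => b < v i) ⊆ univ.filter fun i => a < v i :=
    fun i hi => by
      rw [mem_filter] at hi ⊢
      exact ⟨hi.1, hab.trans_lt hi.2⟩
  rw [← cast_card_sdiff hP, ← cast_card_sdiff hA, Nat.abs_cast, Nat.abs_cast]
  refine Nat.cast_le.2 (card_le_card fun i hi => ?_)
  simp only [mem_sdiff, mem_filter, mem_univ, true_and, not_and] at hi ⊢
  exact ⟨hi.1.2, hi.2 hi.1.1⟩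

/-- Replacing the threshold `t` by an order statistic changes the number of selected points by
little. -/
theorem abs_card_orderStat_sub_le {n : ℕ} (v : Fin n → ℝ) {k : ℕ} (h1 : 1 ≤ k) (h2 : k ≤ n)
    {t x : ℝ} (hties : ∀ i j, v i = v j → t ≤ v i → i = j) (hk : (k : ℝ) ≤ x) (hk1 : x < k + 1) :
    |(#(univ.filter fun i => orderStat v k < v i) : ℝ) - #(univ.filter fun i => t < v i)| ≤
      |(#(univ.filter fun i => t < v i) : ℝ) - x| + 2 := by
  have hle : (#(univ.filter fun i => orderStat v k < v i) : ℝ) + 1 ≤ k := by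
    exact_mod_cast card_orderStat_lt v h1 h2
  -- Below t ties are possible, but there the difference is nonnegative and the upper bound k - 1 ≤
  -- x suffices. From t on, exactly k - 1 values exceed the order statistic, and x < k + 1 costs the
  -- 2.
  rcases lt_or_ge (orderStat v k) t with h | h
  · have hsub : (#(univ.filter fun i => t < v i) : ℝ) ≤
        #(univ.filter fun i => orderStat v k < v i) := by
      refine Nat.cast_le.2 (card_le_card fun i hi => ?_)
      rw [mem_filter] at hi ⊢
      exact ⟨hi.1, h.trans hi.2⟩
    rw [abs_of_nonneg (by linarith)]
    have := neg_abs_le ((#(univ.filter fun i => t < v i) : ℝ) - x)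
    linarith
  · have hsub : (#(univ.filter fun i => orderStat v k < v i) : ℝ) ≤
        #(univ.filter fun i => t < v i) := by
      refine Nat.cast_le.2 (card_le_card fun i hi => ?_)
      rw [mem_filter] at hi ⊢
      exact ⟨hi.1, h.trans_lt hi.2⟩
    have hge : (k : ℝ) ≤ #(univ.filter fun i => orderStat v k < v i) + 1 := by
      exact_mod_cast le_card_orderStat_lt v h1 h2 hties h
    rw [abs_of_nonpos (by linarith)]
    have := le_abs_self ((#(univ.filter fun i => t < v i) : ℝ) - x)
    linarith

end OrderStatistics

/-! ### The quantile of the norm and the conditional form of the risk. -/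

section Quantile

open Filter Topology

variable {E : Type*} [NormedAddCommGroup E] [MeasurableSpace E] {μ : Measure (E × ℤˣ)}

theorem ae_eq_normQuantile {α : ℝ} (h0 : μ {z | ‖z.1‖ = normQuantile μ α} = 0) :
    {z : E × ℤˣ | normQuantile μ α < ‖z.1‖} =ᵐ[μ] {z | normQuantile μ α ≤ ‖z.1‖} := by
  have h1 : ∀ᵐ z ∂μ, ‖z.1‖ ≠ normQuantile μ α := by
    rw [ae_iff]
    simpa using h0
  filter_upwards [h1] with z hz
  exact propext ⟨fun h => le_of_lt h, fun h => lt_of_le_of_ne h hz.symm⟩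

variable [IsProbabilityMeasure μ]

variable (μ) in
theorem bddBelow_quantile {α : ℝ} (hα1 : α < 1) :
    BddBelow {t : ℝ | μ.real {z : E × ℤˣ | t < ‖z.1‖} ≤ α} := by
  refine ⟨0, fun t ht => ?_⟩
  by_contra hcon
  have : {z : E × ℤˣ | t < ‖z.1‖} = Set.univ :=
    Set.eq_univ_of_forall fun z => (not_le.1 hcon).trans_le (norm_nonneg _)
  rw [Set.mem_ofPred_eq, this, probReal_univ] at ht
  linarith

theorem lt_measureReal_of_lt_normQuantile {α : ℝ} (hα1 : α < 1) {t : ℝ}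
    (ht : t < normQuantile μ α) : α < μ.real {z | t < ‖z.1‖} := by
  by_contra hcon
  exact absurd (csInf_le (bddBelow_quantile μ hα1) (not_lt.1 hcon)) (not_le.2 ht)

variable [BorelSpace E]

theorem measurableSet_lt_norm (t : ℝ) : MeasurableSet {z : E × ℤˣ | t < ‖z.1‖} :=
  measurableSet_lt measurable_const measurable_fst.norm

theorem measurableSet_le_norm (t : ℝ) : MeasurableSet {z : E × ℤˣ | t ≤ ‖z.1‖} :=
  measurableSet_le measurable_const measurable_fst.norm

variable (μ) in
theorem nonempty_quantile {α : ℝ} (hα : 0 < α) :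
    {t : ℝ | μ.real {z : E × ℤˣ | t < ‖z.1‖} ≤ α}.Nonempty := by
  have h := tendsto_measure_iInter_atTop (μ := μ) (s := fun n : ℕ => {z : E × ℤˣ | (n : ℝ) < ‖z.1‖})
    (fun n => (measurableSet_lt_norm _).nullMeasurableSet)
    (fun m n hmn z (hz : (n : ℝ) < ‖z.1‖) => (Nat.cast_le.2 hmn).trans_lt hz)
    ⟨0, measure_ne_top _ _⟩
  have h0 : ⋂ n : ℕ, {z : E × ℤˣ | (n : ℝ) < ‖z.1‖} = ∅ := by
    ext z
    obtain ⟨n, hn⟩ := exists_nat_ge ‖z.1‖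
    simpa using ⟨n, hn⟩
  rw [h0, measure_empty] at h
  obtain ⟨n, hn⟩ := (h.eventually (gt_mem_nhds (ENNReal.ofReal_pos.2 hα))).exists
  exact ⟨n, ENNReal.toReal_le_of_le_ofReal hα.le hn.le⟩

theorem measureReal_lt_norm_le_of_normQuantile_lt {α : ℝ} (hα : 0 < α) {t : ℝ}
    (ht : normQuantile μ α < t) : μ.real {z | t < ‖z.1‖} ≤ α := by
  obtain ⟨s, hs, hst⟩ := exists_lt_of_csInf_lt (nonempty_quantile μ hα) ht
  exact (measureReal_mono fun z hz => hst.trans hz).trans hs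

theorem measureReal_normQuantile_lt_le {α : ℝ} (hα : 0 < α) :
    μ.real {z | normQuantile μ α < ‖z.1‖} ≤ α := by
  set t := normQuantile μ α with ht
  obtain ⟨u, hu, hut, hlim⟩ := exists_seq_strictAnti_tendsto t
  have h := tendsto_measure_iUnion_atTop (μ := μ) (s := fun n : ℕ => {z : E × ℤˣ | u n < ‖z.1‖})
    (fun m n hmn z hz => lt_of_le_of_lt (hu.antitone hmn) hz)
  have h0 : ⋃ n : ℕ, {z : E × ℤˣ | u n < ‖z.1‖} = {z | t < ‖z.1‖} := by
    ext z
    simp only [Set.mem_iUnion, Set.mem_ofPred_eq]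
    exact ⟨fun ⟨n, hn⟩ => (hut n).trans hn, fun hz => (hlim.eventually (gt_mem_nhds hz)).exists⟩
  rw [h0] at h
  refine ENNReal.toReal_le_of_le_ofReal hα.le (le_of_tendsto' h fun n => ?_)
  exact (ENNReal.le_ofReal_iff_toReal_le (measure_ne_top _ _) hα.le).2
    (measureReal_lt_norm_le_of_normQuantile_lt hα (hut n))

theorem le_measureReal_normQuantile_le {α : ℝ} (hα1 : α < 1) :
    α ≤ μ.real {z | normQuantile μ α ≤ ‖z.1‖} := by
  set t := normQuantile μ α with ht
  obtain ⟨u, hu, hut, hlim⟩ := exists_seq_strictMono_tendsto t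
  have h := tendsto_measure_iInter_atTop (μ := μ) (s := fun n : ℕ => {z : E × ℤˣ | u n < ‖z.1‖})
    (fun n => (measurableSet_lt_norm _).nullMeasurableSet)
    (fun m n hmn z hz => lt_of_le_of_lt (hu.monotone hmn) hz) ⟨0, measure_ne_top _ _⟩
  have h0 : ⋂ n : ℕ, {z : E × ℤˣ | u n < ‖z.1‖} = {z | t ≤ ‖z.1‖} := by
    ext z
    simp only [Set.mem_iInter, Set.mem_ofPred_eq]
    exact ⟨fun hz => le_of_tendsto' hlim fun n => (hz n).le, fun hz n => (hut n).trans_le hz⟩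
  rw [h0] at h
  refine (ENNReal.ofReal_le_iff_le_toReal (measure_ne_top _ _)).1 (ge_of_tendsto' h fun n => ?_)
  exact (ENNReal.ofReal_le_iff_le_toReal (measure_ne_top _ _)).2
    (lt_measureReal_of_lt_normQuantile hα1 (hut n)).le

/-- Thresholds decreasing to the quantile bound the open tail above by α, thresholds increasing to
it bound the closed tail below by α; the absence of an atom equates the two tails. -/
theorem measureReal_normQuantile_lt {α : ℝ} (hα : 0 < α) (hα1 : α < 1)
    (h0 : μ {z | ‖z.1‖ = normQuantile μ α} = 0) :
    μ.real {z | normQuantile μ α < ‖z.1‖} = α := by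
  refine le_antisymm (measureReal_normQuantile_lt_le hα) ?_
  rw [measureReal_congr (ae_eq_normQuantile h0)]
  exact le_measureReal_normQuantile_le hα1

theorem extremeRisk_eq_cond {α : ℝ} (hα : 0 < α) (hα1 : α < 1)
    (h0 : μ {z | ‖z.1‖ = normQuantile μ α} = 0) (g : E → ℤˣ) :
    extremeRisk μ α g =
      (μ[|{z | normQuantile μ α ≤ ‖z.1‖}]).real {z | z.2 ≠ g z.1} := by
  rw [measureReal_def, cond_apply (measurableSet_le_norm _), ENNReal.toReal_mul, ENNReal.toReal_inv,
    ← measureReal_def, ← measureReal_def, ← measureReal_congr (ae_eq_normQuantile h0),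
    measureReal_normQuantile_lt hα hα1 h0, extremeRisk, one_div]
  congr 1
  refine measureReal_congr ?_
  have h := (ae_eq_normQuantile h0).inter (ae_eq_refl {z : E × ℤˣ | z.2 ≠ g z.1})
  refine EventuallyEq.trans (EventuallyEq.of_eq ?_) h
  ext z
  exact and_comm

end Quantile

/-! ### VC dimension and measurability of the error sets. -/

section ErrorSets

variable {E : Type*} [NormedAddCommGroup E]

/-- The points with norm above `t` misclassified by `g`. -/
def errorSet (t : ℝ) (g : E → ℤˣ) : Set (E × ℤˣ) := {z | z.2 ≠ g z.1 ∧ t < ‖z.1‖}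

theorem hasTraceDim_errorSet {G : Set (E → ℤˣ)} {V : ℕ} (hV : vcDimension G = V) (t : ℝ) :
    HasTraceDim (fun g : G => errorSet t g.1) V := by
  classical
  intro n z s hs
  -- If two indices share their point, a classifier wrong at both forces equal labels; then every
  -- classifier errs at both or at neither, and {i} cannot be cut out.
  have hinj : Set.InjOn (fun i => (z i).1) (s : Set (Fin n)) := by
    intro i hi j hj hij
    by_contra hne
    obtain ⟨g, hg⟩ := hs {i} (by simpa using hi)
    obtain ⟨g', hg'⟩ := hs s subset_rfl
    have h1 := (hg i hi).2 (by simp)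
    have h2 := mt (hg j hj).1 (by simpa using Ne.symm hne)
    have h3 := (hg' i hi).2 hi
    have h4 := (hg' j hj).2 hj
    simp only [errorSet, Set.mem_ofPred_eq, not_and_or, not_not] at h1 h2 h3 h4
    simp only at hij
    rw [← hij] at h2 h4
    have h5 : (z j).2 = g.1 (z i).1 := h2.resolve_right (not_not.2 h4.2)
    have h6 : (z i).2 = (z j).2 := by
      rcases Int.units_eq_one_or (z i).2 with h | h <;>
      rcases Int.units_eq_one_or (z j).2 with h' | h' <;>
      rcases Int.units_eq_one_or (g'.1 (z i).1) with h'' | h'' <;>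
      simp_all
    exact h1.1 (h6.trans h5)
  have hsh : Shatters G (s.image fun i => (z i).1) := by
    intro T _
    -- These are the indices where the labelling given by T disagrees with the observed label. The
    -- second classifier, wrong on all of s, shows that every point of s has norm above t.
    obtain ⟨g, hg⟩ := hs (s.filter fun i => ((z i).2 = 1 ↔ (z i).1 ∉ T)) (Finset.filter_subset _ _)
    obtain ⟨g', hg'⟩ := hs s subset_rfl
    refine ⟨g.1, g.2, fun x hx => ?_⟩
    obtain ⟨i, hi, rfl⟩ := Finset.mem_image.1 hx
    have h1 := hg i hi
    have h2 := ((hg' i hi).2 hi).2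
    simp only [errorSet, Set.mem_ofPred_eq, Finset.mem_filter, hi, true_and, h2, and_true] at h1
    rcases Int.units_eq_one_or (z i).2 with h | h <;>
      rcases Int.units_eq_one_or (g.1 (z i).1) with h' | h' <;>
      simp_all
  have hle : ((s.image fun i => (z i).1).card : ℕ∞) ≤ vcDimension G :=
    le_iSup₂_of_le (f := fun (S : Finset E) (_ : Shatters G S) => (S.card : ℕ∞)) _ hsh le_rfl
  rw [hV, Finset.card_image_of_injOn hinj] at hle
  exact_mod_cast hle

variable [MeasurableSpace E] [BorelSpace E] {μ : Measure (E × ℤˣ)}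

theorem measurableSet_errorSet (t : ℝ) {g : E → ℤˣ} (hg : Measurable g) :
    MeasurableSet (errorSet t g) := by
  have h1 : Measurable fun z : E × ℤˣ => ((z.2 : ℤ), (g z.1 : ℤ)) := by
    have hu : Measurable (Units.val : ℤˣ → ℤ) := comap_measurable _
    exact (hu.comp measurable_snd).prodMk (hu.comp (hg.comp measurable_fst))
  have h2 : MeasurableSet {z : E × ℤˣ | z.2 ≠ g z.1} := by
    have h3 : MeasurableSet {q : ℤ × ℤ | q.1 ≠ q.2} := MeasurableSet.of_discrete
    convert h1 h3 using 1
    ext z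
    simp [Units.ext_iff]
  exact h2.inter (measurableSet_lt_norm t)

theorem measurableSet_hitSet_eq {X : Type*} [MeasurableSpace X] {U : Set X} (hU : MeasurableSet U)
    {m : ℕ} (S : Finset (Fin m)) : MeasurableSet {z : Fin m → X | hitSet U z = S} := by
  have : {z : Fin m → X | hitSet U z = S} =
      Set.univ.pi fun i => if i ∈ S then U else Uᶜ := by
    ext z
    simp only [Set.mem_ofPred_eq, Set.mem_univ_pi, Finset.ext_iff, mem_hitSet]
    refine forall_congr' fun i => ?_
    by_cases h : i ∈ S <;> simp [h]
  rw [this]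
  refine MeasurableSet.univ_pi fun i => ?_
  split_ifs
  exacts [hU, hU.compl]

/-- Partition the sample space by which points exceed t. On each piece the threshold amounts to
setting some weights to 0, and there are finitely many measurable pieces. -/
theorem hasMeasurableSup_errorSet {G : Set (E → ℤˣ)} (hG : IsMeasurableClass μ G) (t : ℝ) :
    HasMeasurableSup μ (fun g : G => errorSet t g.1) := by
  classical
  intro m e
  set U : Set (E × ℤˣ) := {z | t < ‖z.1‖} with hUdef
  set h : Finset (Fin m) → (Fin m → E × ℤˣ) → ℝ := fun S z =>
    ⨆ g : G, |∑ i : Fin m, (if i ∈ S then e i else 0) *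
      if (z i).2 ≠ g.1 (z i).1 then (1 : ℝ) else 0| with hh
  have hsum : AEMeasurable (fun z => ∑ S : Finset (Fin m),
      {z : Fin m → E × ℤˣ | hitSet U z = S}.indicator (h S) z) (Measure.pi fun _ => μ) := by
    refine Finset.aemeasurable_fun_sum _ fun S _ => ?_
    exact (hG.2 m _).indicator (measurableSet_hitSet_eq (measurableSet_lt_norm t) S)
  refine hsum.congr (Filter.Eventually.of_forall fun z => ?_)
  simp only
  rw [Finset.sum_eq_single (hitSet U z)]
  · rw [Set.indicator_of_mem (by simp)]
    simp only [hh]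
    refine iSup_congr fun g => congrArg abs (Finset.sum_congr rfl fun i _ => ?_)
    by_cases h1 : t < ‖(z i).1‖ <;> simp [mem_hitSet, hUdef, errorSet, Set.indicator_apply, h1]
  · intro S _ hS
    exact Set.indicator_of_notMem (fun hz => hS hz.symm) _
  · simp

end ErrorSets

/-! ### Constants, the sample, and the final estimate. -/

section Main

open Finset

/-- The constant of the main theorem. -/
noncomputable def deviationConst (ℓ₀ : ℝ) : ℝ :=
  384 * √(1 + 1 / ℓ₀) + 2 / ℓ₀ + 1 / √ℓ₀ + 1

theorem deviationConst_pos {ℓ₀ : ℝ} (h : 0 < ℓ₀) : 0 < deviationConst ℓ₀ := by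
  unfold deviationConst
  positivity

/-- The trivial regime: either the square root is at least √ℓ₀ or the linear term is at least 1. -/
theorem one_le_deviationConst_mul {ℓ₀ ℓ x : ℝ} {V : ℕ} (hℓ₀ : 0 < ℓ₀) (hℓ : ℓ₀ ≤ ℓ) (hx : 0 < x)
    (h : x < V ∨ x < ℓ) :
    1 ≤ deviationConst ℓ₀ * (√(V / x * ℓ) + 1 / x * ℓ) := by
  have hℓp : 0 < ℓ := hℓ₀.trans_le hℓ
  have h1 : 0 ≤ √(V / x * ℓ) := Real.sqrt_nonneg _
  have h2 : 0 ≤ 1 / x * ℓ := by positivity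
  have hs : 0 < √ℓ₀ := Real.sqrt_pos.2 hℓ₀
  have hC : 1 / √ℓ₀ ≤ deviationConst ℓ₀ ∧ 1 ≤ deviationConst ℓ₀ := by
    have h3 : 0 ≤ 384 * √(1 + 1 / ℓ₀) := by positivity
    have h4 : 0 ≤ 2 / ℓ₀ := by positivity
    have h5 : 0 ≤ 1 / √ℓ₀ := by positivity
    unfold deviationConst
    constructor <;> linarith
  rcases h with h | h
  · have h3 : √ℓ₀ ≤ √(V / x * ℓ) := by
      refine Real.sqrt_le_sqrt (hℓ.trans (le_mul_of_one_le_left hℓp.le ?_))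
      rw [le_div_iff₀ hx]
      linarith
    calc (1 : ℝ) = 1 / √ℓ₀ * √ℓ₀ := by field_simp
      _ ≤ deviationConst ℓ₀ * (√(V / x * ℓ) + 1 / x * ℓ) :=
        mul_le_mul hC.1 (by linarith) hs.le (by linarith [hC.2])
  · have h3 : 1 ≤ 1 / x * ℓ := by
      rw [one_div, inv_mul_eq_div, le_div_iff₀ hx]
      linarith
    calc (1 : ℝ) = 1 * 1 := by ring
      _ ≤ deviationConst ℓ₀ * (√(V / x * ℓ) + 1 / x * ℓ) :=
        mul_le_mul hC.2 (by linarith) zero_le_one (by linarith [hC.2])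

/-- From ℓ ≤ Vℓ and V ≤ Vℓ/ℓ₀ one gets V + ℓ ≤ (1 + 1/ℓ₀)Vℓ. -/
theorem le_deviationConst_mul {ℓ₀ ℓ x : ℝ} {V : ℕ} (hV : 1 ≤ V) (hℓ₀ : 0 < ℓ₀) (hℓ : ℓ₀ ≤ ℓ)
    (hx : 0 < x) :
    384 * √((V + ℓ) / x) + 2 / x ≤ deviationConst ℓ₀ * (√(V / x * ℓ) + 1 / x * ℓ) := by
  have hV1 : (1 : ℝ) ≤ V := by exact_mod_cast hV
  have hℓp : 0 < ℓ := hℓ₀.trans_le hℓ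
  have h1 : √((V + ℓ) / x) ≤ √(1 + 1 / ℓ₀) * √(V / x * ℓ) := by
    rw [← Real.sqrt_mul (by positivity)]
    refine Real.sqrt_le_sqrt ?_
    have h2 : (1 + 1 / ℓ₀) * (V / x * ℓ) = ((V * ℓ) + V * (ℓ / ℓ₀)) / x := by
      field_simp
    rw [h2]
    have h3 : 1 ≤ ℓ / ℓ₀ := by rwa [le_div_iff₀ hℓ₀, one_mul]
    refine div_le_div_of_nonneg_right (?_ : (V : ℝ) + ℓ ≤ V * ℓ + V * (ℓ / ℓ₀)) hx.le
    nlinarith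
  have h2 : 2 / x ≤ 2 / ℓ₀ * (1 / x * ℓ) := by
    have : 2 / ℓ₀ * (1 / x * ℓ) = 2 / x * (ℓ / ℓ₀) := by field_simp
    rw [this]
    refine le_mul_of_one_le_right (by positivity) ?_
    rwa [le_div_iff₀ hℓ₀, one_mul]
  have h3 : 0 ≤ √(V / x * ℓ) := Real.sqrt_nonneg _
  have h4 : 0 ≤ 1 / x * ℓ := by positivity
  have h5 : 0 ≤ 1 / √ℓ₀ := by positivity
  have h6 : 0 ≤ 2 / ℓ₀ := by positivity
  have h7 : 0 ≤ √(1 + 1 / ℓ₀) := Real.sqrt_nonneg _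
  unfold deviationConst
  nlinarith [mul_nonneg h6 h3, mul_nonneg h7 h4, mul_nonneg h5 h3, mul_nonneg h5 h4]

/-- Since r²x = V + ℓ, eight times the right side of `h` is at most 172V + 12ℓ + 16, hence at most
192r²x because V ≥ 1. -/
theorem le_of_mul_le_of_eq_sqrt {V : ℕ} {ℓ x r l d δ : ℝ} (hV : 1 ≤ V) (hδ : 0 < δ)
    (hℓ : ℓ = Real.log (1 / δ)) (hx : 0 < x) (hℓ0 : 0 < ℓ)
    (hr : r = √((V + ℓ) / x)) (hl : l = r / 8)
    (h : l * d ≤ 21 * V + 32 * l ^ 2 * x + Real.log (3 / δ)) : d ≤ 192 * r * x := by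
  have hV1 : (1 : ℝ) ≤ V := by exact_mod_cast hV
  have hr2 : r ^ 2 * x = V + ℓ := by
    rw [hr, Real.sq_sqrt (by positivity)]
    field_simp
  have hrp : 0 < r := by rw [hr]; positivity
  have hlog : Real.log (3 / δ) ≤ 2 + ℓ := by
    have h3 := Real.log_le_sub_one_of_pos (show (0 : ℝ) < 3 by norm_num)
    rw [hℓ, show 3 / δ = 3 * (1 / δ) by ring, Real.log_mul (by norm_num) (by positivity)]
    linarith
  rw [hl] at h
  have h4 : 32 * (r / 8) ^ 2 * x = (V + ℓ) / 2 := by rw [← hr2]; ring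
  rw [h4] at h
  have h5 : r * d ≤ r * (192 * r * x) := by
    have : r * (192 * r * x) = 192 * (V + ℓ) := by rw [← hr2]; ring
    rw [this]
    linarith
  exact le_of_mul_le_mul_left h5 hrp

variable {E : Type*} [NormedAddCommGroup E]

open Classical in
theorem empiricalExtremeRisk_eq {n : ℕ} (α : ℝ) (z : Fin n → E × ℤˣ) (g : E → ℤˣ) :
    empiricalExtremeRisk α z g = 1 / (n * α) *
      #(univ.filter fun i => (z i).2 ≠ g (z i).1 ∧
        orderStat (fun j => ‖(z j).1‖) ⌊n * α⌋₊ < ‖(z i).1‖) := by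
  rw [empiricalExtremeRisk, Finset.sum_boole]

theorem empiricalExtremeRisk_mem_Icc {n : ℕ} {α : ℝ} (hα1 : α < 1) (hnα : 1 ≤ n * α)
    (z : Fin n → E × ℤˣ) (g : E → ℤˣ) : empiricalExtremeRisk α z g ∈ Set.Icc (0 : ℝ) 1 := by
  classical
  have hx : 0 < n * α := by linarith
  have h1 : 1 ≤ ⌊n * α⌋₊ := Nat.one_le_floor_iff _ |>.2 hnα
  have h2 : ⌊n * α⌋₊ ≤ n := Nat.floor_le_of_le (mul_le_of_le_one_right (by positivity) hα1.le)
  rw [empiricalExtremeRisk_eq]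
  refine ⟨by positivity, ?_⟩
  rw [one_div, inv_mul_le_iff₀ hx, mul_one]
  have h3 := card_orderStat_lt (fun j => ‖(z j).1‖) h1 h2
  have h4 : #(univ.filter fun i => (z i).2 ≠ g (z i).1 ∧
      orderStat (fun j => ‖(z j).1‖) ⌊n * α⌋₊ < ‖(z i).1‖) ≤ ⌊n * α⌋₊ := by
    refine le_trans (card_le_card fun i hi => ?_) (Nat.le_of_succ_le h3)
    rw [mem_filter] at hi ⊢
    exact ⟨hi.1, hi.2.2⟩
  exact (Nat.cast_le.2 h4).trans (Nat.floor_le hx.le)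

theorem abs_empiricalExtremeRisk_sub_le {n : ℕ} {α t : ℝ} (hα1 : α < 1)
    (hnα : 1 ≤ n * α) (z : Fin n → E × ℤˣ) (g : E → ℤˣ)
    (hties : ∀ i j, ‖(z i).1‖ = ‖(z j).1‖ → t ≤ ‖(z i).1‖ → i = j) :
    |empiricalExtremeRisk α z g - 1 / (n * α) * #(hitSet (errorSet t g) z)| ≤
      1 / (n * α) * (|(#(hitSet {z : E × ℤˣ | t < ‖z.1‖} z) : ℝ) - n * α| + 2) := by
  classical
  have hx : 0 < n * α := by linarith
  have h1 : 1 ≤ ⌊n * α⌋₊ := Nat.one_le_floor_iff _ |>.2 hnα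
  have h2 : ⌊n * α⌋₊ ≤ n := Nat.floor_le_of_le (mul_le_of_le_one_right (by positivity) hα1.le)
  have hA := abs_card_sub_card_le (fun j => ‖(z j).1‖) (fun i => (z i).2 ≠ g (z i).1)
    (orderStat (fun j => ‖(z j).1‖) ⌊n * α⌋₊) t
  have hB := abs_card_orderStat_sub_le (fun j => ‖(z j).1‖) h1 h2 hties (Nat.floor_le hx.le)
    (Nat.lt_floor_add_one _)
  have e1 : univ.filter (fun i => (z i).2 ≠ g (z i).1 ∧ t < ‖(z i).1‖) =
      hitSet (errorSet t g) z := by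
    ext i
    simp [mem_hitSet, errorSet]
  have e2 : univ.filter (fun i => t < ‖(z i).1‖) = hitSet {z : E × ℤˣ | t < ‖z.1‖} z := by
    ext i
    simp [mem_hitSet]
  simp only [e1, e2] at hA hB
  rw [empiricalExtremeRisk_eq, ← mul_sub, abs_mul, abs_of_nonneg (by positivity)]
  gcongr
  exact hA.trans hB

variable [MeasurableSpace E] {μ : Measure (E × ℤˣ)}

theorem extremeRisk_eq (α : ℝ) (g : E → ℤˣ) :
    extremeRisk μ α g = 1 / α * μ.real (errorSet (normQuantile μ α) g) := rfl

variable [IsProbabilityMeasure μ]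

theorem extremeRisk_mem_Icc [BorelSpace E] {α : ℝ} (hα : 0 < α) (g : E → ℤˣ) :
    extremeRisk μ α g ∈ Set.Icc (0 : ℝ) 1 := by
  rw [extremeRisk_eq]
  refine ⟨by positivity, ?_⟩
  rw [one_div, inv_mul_le_iff₀ hα, mul_one]
  exact (measureReal_mono fun z hz => hz.2).trans (measureReal_normQuantile_lt_le hα)

/-- Fubini: given one point of norm at least t₀, an independent one has the same norm with
probability zero. -/
theorem ae_no_ties [BorelSpace E] {Ω : Type*} [MeasurableSpace Ω] {P : Measure Ω}
    [IsProbabilityMeasure P] {n : ℕ} {Z : Fin n → Ω → E × ℤˣ} (hZ : ∀ i, HasLaw (Z i) μ P)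
    (hind : iIndepFun Z P) {t₀ : ℝ} (h0 : ∀ t, t₀ ≤ t → μ {z | ‖z.1‖ = t} = 0) :
    ∀ᵐ ω ∂P, ∀ i j, ‖(Z i ω).1‖ = ‖(Z j ω).1‖ → t₀ ≤ ‖(Z i ω).1‖ → i = j := by
  simp only [ae_all_iff]
  intro i j
  rcases eq_or_ne i j with hij | hij
  · exact Filter.Eventually.of_forall fun _ _ _ => hij
  have hmap : P.map (fun ω => (Z i ω, Z j ω)) = μ.prod μ := by
    rw [(indepFun_iff_map_prod_eq_prod_map_map (hZ i).aemeasurable (hZ j).aemeasurable).1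
      (hind.indepFun hij), (hZ i).map_eq, (hZ j).map_eq]
  set T : Set ((E × ℤˣ) × (E × ℤˣ)) := {q | ‖q.1.1‖ = ‖q.2.1‖ ∧ t₀ ≤ ‖q.1.1‖} with hT
  have hTm : MeasurableSet T :=
    (measurableSet_eq_fun measurable_fst.fst.norm measurable_snd.fst.norm).inter
      (measurableSet_le measurable_const measurable_fst.fst.norm)
  have hT0 : μ.prod μ T = 0 := by
    rw [Measure.measure_prod_null hTm]
    refine Filter.Eventually.of_forall fun p => ?_
    by_cases hp : t₀ ≤ ‖p.1‖
    · refine measure_mono_null (fun q hq => ?_) (h0 ‖p.1‖ hp)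
      exact hq.1.symm
    · have : Prod.mk p ⁻¹' T = ∅ := by
        ext q
        simp [hT, hp]
      simp [this]
  rw [← hmap] at hT0
  have h1 : ∀ᵐ q ∂P.map (fun ω => (Z i ω, Z j ω)), q ∉ T := measure_eq_zero_iff_ae_notMem.1 hT0
  filter_upwards [ae_of_ae_map ((hZ i).aemeasurable.prodMk (hZ j).aemeasurable) h1] with ω hω h2 h3
  exact absurd ⟨h2, h3⟩ hω

/-- Only an inequality, via the measurable hull, since the bad set of samples need not be
measurable. -/
theorem measure_sample_le {X Ω : Type*} [MeasurableSpace X] [MeasurableSpace Ω] {μ : Measure X}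
    [IsProbabilityMeasure μ] {P : Measure Ω} [IsProbabilityMeasure P] {n : ℕ} {Z : Fin n → Ω → X}
    (hZ : ∀ i, HasLaw (Z i) μ P) (hind : iIndepFun Z P) (B : Set (Fin n → X)) :
    P {ω | (fun i => Z i ω) ∈ B} ≤ (Measure.pi fun _ => μ) B := by
  have hm : AEMeasurable (fun ω i => Z i ω) P := aemeasurable_pi_lambda _ fun i => (hZ i).aemeasurable
  have h1 : P.map (fun ω i => Z i ω) = Measure.pi fun _ => μ := by
    rw [(iIndepFun_iff_map_fun_eq_pi_map fun i => (hZ i).aemeasurable).1 hind]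
    simp only [(hZ _).map_eq]
  rw [← h1, ← measure_toMeasurable (μ := P.map _) B, Measure.map_apply_of_aemeasurable hm
    (measurableSet_toMeasurable _ _)]
  exact measure_mono fun ω hω => subset_toMeasurable _ _ hω

theorem exists_measurableSet_of_compl_le {Ω : Type*} [MeasurableSpace Ω] {P : Measure Ω}
    [IsProbabilityMeasure P] {B : Set Ω} {δ : ℝ} (hδ : 0 ≤ δ) (hB : P B ≤ ENNReal.ofReal δ) :
    ∃ A : Set Ω, MeasurableSet A ∧ 1 - δ ≤ P.real A ∧ ∀ ω ∈ A, ω ∉ B := by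
  refine ⟨(toMeasurable P B)ᶜ, (measurableSet_toMeasurable _ _).compl, ?_,
    fun ω hω hωB => hω (subset_toMeasurable _ _ hωB)⟩
  rw [probReal_compl_eq_one_sub (measurableSet_toMeasurable _ _), measureReal_def,
    measure_toMeasurable]
  have := ENNReal.toReal_le_of_le_ofReal hδ hB
  linarith

theorem exists_event_deviation_le [BorelSpace E] {G : Set (E → ℤˣ)} {V : ℕ} {α ℓ₀ δ : ℝ}
    (hG : IsMeasurableClass μ G) (hV : vcDimension G = V) (hV1 : 1 ≤ V) (hα : 0 < α)
    (hα1 : α < 1) (h0 : ∀ t : ℝ, normQuantile μ α ≤ t → μ {z | ‖z.1‖ = t} = 0)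
    {Ω : Type*} [MeasurableSpace Ω] {P : Measure Ω} [IsProbabilityMeasure P] {n : ℕ}
    {Z : Fin n → Ω → E × ℤˣ} (hnα : 1 ≤ n * α) (hZ : ∀ i, HasLaw (Z i) μ P)
    (hind : iIndepFun Z P) (hδ : 0 < δ) (hℓ₀ : 0 < ℓ₀) (hℓ : ℓ₀ ≤ Real.log (1 / δ)) :
    ∃ A : Set Ω, MeasurableSet A ∧ 1 - δ ≤ P.real A ∧ ∀ ω ∈ A, ∀ g ∈ G,
      |empiricalExtremeRisk α (fun i => Z i ω) g - extremeRisk μ α g| ≤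
        deviationConst ℓ₀ *
          (√(V / (n * α) * Real.log (1 / δ)) + 1 / (n * α) * Real.log (1 / δ)) := by
  set x : ℝ := n * α with hxdef
  set ℓ : ℝ := Real.log (1 / δ) with hℓdef
  have hx : 0 < x := by linarith
  have hℓp : 0 < ℓ := hℓ₀.trans_le hℓ
  by_cases htriv : x < V ∨ x < ℓ
  · refine ⟨Set.univ, MeasurableSet.univ, by rw [probReal_univ]; linarith, fun ω _ g _ => ?_⟩
    refine le_trans ?_ (one_le_deviationConst_mul hℓ₀ hℓ hx htriv)
    have h1 := empiricalExtremeRisk_mem_Icc hα1 hnα (fun i => Z i ω) g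
    have h2 := extremeRisk_mem_Icc (μ := μ) hα g
    rw [abs_le]
    constructor <;> linarith [h1.1, h1.2, h2.1, h2.2]
  rw [not_or, not_lt, not_lt] at htriv
  set t := normQuantile μ α with ht
  set U : Set (E × ℤˣ) := {z | t < ‖z.1‖} with hU
  have hUα : μ.real U = α := measureReal_normQuantile_lt hα hα1 (h0 t le_rfl)
  set r : ℝ := √((V + ℓ) / x) with hr
  -- Outside the trivial regime V + ℓ ≤ 2x, so l = r/8 satisfies 4l ≤ 1.
  have hr2 : r ≤ 2 := by
    rw [hr, Real.sqrt_le_left (by norm_num), div_le_iff₀ hx]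
    linarith [htriv.1, htriv.2]
  have hr0 : 0 ≤ r := Real.sqrt_nonneg _
  have hne : Nonempty G := by
    by_contra hcon
    rw [Set.nonempty_coe_sort, Set.not_nonempty_iff_eq_empty] at hcon
    have h1 : vcDimension G = 0 := by
      rw [vcDimension, ← bot_eq_zero, eq_bot_iff]
      refine iSup₂_le fun S hS => ?_
      obtain ⟨g, hg, -⟩ := hS ∅ (empty_subset _)
      rw [hcon] at hg
      exact absurd hg (Set.notMem_empty g)
    rw [hV] at h1
    have : V = 0 := by exact_mod_cast h1
    omega
  have hdev := measure_deviation_le (μ := μ) (c := fun g : G => errorSet t g.1) (U := U) hV1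
    (measurableSet_lt_norm t) (fun g => measurableSet_errorSet t (hG.1 g.1 g.2))
    (fun g z hz => hz.2) (hasTraceDim_errorSet hV t) (hasMeasurableSup_errorSet hG t) n
    (l := r / 8) (δ := δ) (by positivity) (by linarith) hδ
  rw [hUα, ← hxdef] at hdev
  have hties := ae_no_ties hZ hind h0
  rw [ae_iff] at hties
  -- The excluded event joins the failure of the deviation bounds, of measure at most δ, to the null
  -- event of a tie.
  obtain ⟨A, hAm, hAδ, hA⟩ := exists_measurableSet_of_compl_le hδ.le
    ((measure_union_le _ _).trans
      ((add_le_add ((measure_sample_le hZ hind _).trans hdev) hties.le).trans_eq (add_zero _)))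
  refine ⟨A, hAm, hAδ, fun ω hω g hg => ?_⟩
  have hω' := hA ω hω
  rw [Set.mem_union, not_or] at hω'
  obtain ⟨hgood, htie⟩ := hω'
  simp only [Set.mem_ofPred_eq, not_not] at hgood htie
  have hd1 := le_of_mul_le_of_eq_sqrt hV1 hδ hℓdef hx hℓp hr rfl (hgood.1 ⟨g, hg⟩)
  have hd2 := le_of_mul_le_of_eq_sqrt hV1 hδ hℓdef hx hℓp hr rfl hgood.2
  have hd3 := abs_empiricalExtremeRisk_sub_le (t := t) hα1 hnα (fun i => Z i ω) g htie
  rw [← hxdef] at hd3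
  have hd4 : |1 / x * (#(hitSet (errorSet t g) fun i => Z i ω) : ℝ) - extremeRisk μ α g| ≤
      1 / x * (192 * r * x) := by
    have hn : (n : ℝ) ≠ 0 := by
      rintro hn
      rw [hxdef, hn, zero_mul] at hx
      exact lt_irrefl _ hx
    have h1 : extremeRisk μ α g = 1 / x * (n * μ.real (errorSet t g)) := by
      rw [extremeRisk_eq, ← ht, hxdef]
      field_simp
    rw [h1, ← mul_sub, abs_mul, abs_of_nonneg (by positivity : (0 : ℝ) ≤ 1 / x)]
    gcongr
  refine le_trans ?_ (le_deviationConst_mul hV1 hℓ₀ hℓ hx)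
  refine (abs_sub_le _ (1 / x * (#(hitSet (errorSet t g) fun i => Z i ω) : ℝ)) _).trans ?_
  calc _ ≤ 1 / x * (192 * r * x + 2) + 1 / x * (192 * r * x) := by
        refine add_le_add (hd3.trans ?_) hd4
        gcongr
    _ = 384 * r + 2 / x := by field_simp; ring

end Main

end ExtremeClassification

open ExtremeClassification in
theorem mainTheorem3 : ∀ δ₀ : ℝ, 0 < δ₀ → δ₀ < 1 → ∃ C : ℝ, 0 < C ∧
    ∀ (E : Type*) [NormedAddCommGroup E] [NormedSpace ℝ E] [FiniteDimensional ℝ E]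
      [MeasurableSpace E] [BorelSpace E]
      (μ : Measure (E × ℤˣ)) [IsProbabilityMeasure μ]
      (G : Set (E → ℤˣ)) (V : ℕ) (α : ℝ),
      IsMeasurableClass μ G →
      vcDimension G = V → 1 ≤ V →
      0 < α → α < 1 →
      -- the distribution function of `‖X‖` is continuous on `[t_α, ∞)`
      (∀ t : ℝ, normQuantile μ α ≤ t → μ {z | ‖z.1‖ = t} = 0) →
      (∀ g ∈ G, extremeRisk μ α g =
        (μ[|{z | normQuantile μ α ≤ ‖z.1‖}]).real {z | z.2 ≠ g z.1}) ∧
      ∀ (Ω : Type*) [MeasurableSpace Ω] (P : Measure Ω) [IsProbabilityMeasure P]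
        (n : ℕ) (Z : Fin n → Ω → E × ℤˣ),
        1 ≤ n * α →
        (∀ i, HasLaw (Z i) μ P) → iIndepFun Z P →
        ∀ δ : ℝ, 0 < δ → δ ≤ δ₀ →
          ∃ A : Set Ω, MeasurableSet A ∧ 1 - δ ≤ P.real A ∧
            ∀ ω ∈ A, ∀ g ∈ G,
              |empiricalExtremeRisk α (fun i => Z i ω) g - extremeRisk μ α g| ≤
                C * (√(V / (n * α) * Real.log (1 / δ)) + 1 / (n * α) * Real.log (1 / δ)) := by
  intro δ₀ hδ₀ hδ₀1
  have hℓ₀ : 0 < Real.log (1 / δ₀) := Real.log_pos ((one_lt_div hδ₀).2 hδ₀1)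
  refine ⟨deviationConst (Real.log (1 / δ₀)), deviationConst_pos hℓ₀, ?_⟩
  intro E _ _ _ _ _ μ _ G V α hG hV hV1 hα hα1 h0
  refine ⟨fun g _ => extremeRisk_eq_cond hα hα1 (h0 _ le_rfl) g, ?_⟩
  intro Ω _ P _ n Z hnα hZ hind δ hδ hδδ₀
  refine exists_event_deviation_le hG hV hV1 hα hα1 h0 hnα hZ hind hδ hℓ₀ ?_
  gcongr
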